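/- For $\alpha\in\mathbb R$ and $n\ge 0$ let $L^{(\alpha)}_n(x)=\frac{e^x x^{-\alpha}}{n!}\frac{d^n}{dx^n}\left(e^{-x}x^{n+\alpha}\right)$ be the Laguerre polynomial. Let $\lambda=(\lambda_1\ge\dots\ge\lambda_{r_1})$ and $\mu=(\mu_1\ge\dots\ge\mu_{r_2})$ be two (possibly empty) partitions into positive integers, $r=r_1+r_2$, $|\lambda|=\sum_j\lambda_j$, $|\mu|=\sum_j\mu_j$, $n_j=\lambda_j+r_1-j$ $(1\le j\le r_1)$ and $m_j=\mu_j+r_2-j$ $(1\le j\le r_2)$. Put $f_j(x)=L^{(\alpha)}_{n_j}(x)$ for $1\le j\le r_1$ and $f_{r_1+j}(x)=e^xL^{(\alpha)}_{m_j}(-x)$ for $1\le j\le r_2$. Let $$\mathbb N_{\lambda,\mu}=\{n\in\mathbb Z_{\ge0}:\ n\ge|\lambda|+|\mu|-r_1,\ n-|\lambda|-|\mu|\ne\lambda_j-j\text{ for }j=1,\dots,r_1\},$$ and for $n\in\mathbb N_{\lambda,\mu}$ define the exceptional Laguerre polynomial $$L^{(\alpha)}_{\lambda,\mu,n}(x)=e^{-r_2x}\,\mathrm{Wr}\left[f_1,\dots,f_r,L^{(\alpha)}_s\right](x),\qquad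 s=n-|\lambda|-|\mu|+r_1,$$ where $\mathrm{Wr}$ is the Wronskian determinant. Its zeros in $(0,\infty)$ are called its regular zeros; let $N(n)$ be their number, counted with multiplicity, and let $0<x^{(\alpha)}_{1,n}\le\dots\le x^{(\alpha)}_{N(n),n}$ be the regular zeros, repeated according to multiplicity. **Theorem.** Let $\alpha\in\mathbb R$ with $\alpha+r>-1$. Then for every bounded continuous function $f:(0,\infty)\to\mathbb R$, $$\lim_{\substack{n\to\infty\\ n\in\mathbb N_{\lambda,\mu}}}\frac1{N(n)}\sum_{j=1}^{N(n)}f\left(\frac{x^{(\alpha)}_{j,n}}{N(n)}\right)=\frac1{2\pi}\int_0^4f(x)\sqrt{\frac{4-x}{x}}\,dx.$$ -/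

import Mathlib

namespace XLaguerre

open Polynomial

/-- The Laguerre polynomial of degree `n` with parameter `α`,
`∑ₖ (-1)ᵏ / k! * binom(n + α, n - k) xᵏ`, where `binom(a, m) = a (a - 1) ⋯ (a - m + 1) / m!`.
See `laguerre_rodrigues` for the Rodrigues formula. -/
noncomputable def laguerre (α : ℝ) (n : ℕ) : ℝ[X] :=
  ∑ k ∈ Finset.range (n + 1),
    C ((-1) ^ k / (k.factorial : ℝ) *
      ((descPochhammer ℝ (n - k)).eval ((n : ℝ) + α) / ((n - k).factorial : ℝ))) * X ^ k

/-- The Rodrigues formula: `Lₙ^(α)(x) = (eˣ x^(-α) / n!) dⁿ/dxⁿ (e^(-x) x^(n+α))` for `x > 0`. -/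
theorem laguerre_rodrigues (α : ℝ) (n : ℕ) {x : ℝ} (hx : 0 < x) :
    (laguerre α n).eval x = Real.exp x * x ^ (-α) / (n.factorial : ℝ) *
      iteratedDeriv n (fun y : ℝ => Real.exp (-y) * y ^ ((n : ℝ) + α)) x := by
  have h1 : ContDiffAt ℝ n (fun y : ℝ => Real.exp (-y)) x := by fun_prop
  have h2 : ContDiffAt ℝ n (fun y : ℝ => y ^ ((n : ℝ) + α)) x :=
    contDiffAt_id.rpow_const_of_ne hx.ne'
  have he : ∀ k : ℕ, iteratedDeriv k (fun y : ℝ => Real.exp (-y)) x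
      = (-1) ^ k * Real.exp (-x) := by
    intro k
    have := congrFun (iteratedDeriv_exp_const_mul k (-1)) x
    simpa using this
  rw [iteratedDeriv_fun_mul h1 h2, laguerre, eval_finsetSum, Finset.mul_sum]
  refine Finset.sum_congr rfl fun k hk => ?_
  have hkn : k ≤ n := Nat.lt_succ_iff.mp (Finset.mem_range.mp hk)
  have hpow : iteratedDeriv (n - k) (fun y : ℝ => y ^ ((n : ℝ) + α)) x
      = (descPochhammer ℝ (n - k)).eval ((n : ℝ) + α) * (x ^ α * x ^ k) := by
    rw [iteratedDeriv_eq_iterate, Real.iter_deriv_rpow_const]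
    rw [← Real.rpow_natCast x k, ← Real.rpow_add hx, Nat.cast_sub hkn]
    congr 2
    ring
  rw [he, hpow]
  have hexp : Real.exp x * Real.exp (-x) = 1 := by rw [← Real.exp_add]; simp
  have hxa : x ^ (-α) * x ^ α = 1 := by rw [← Real.rpow_add hx]; simp
  have hch : (n.choose k : ℝ) / (n.factorial : ℝ)
      = 1 / ((k.factorial : ℝ) * ((n - k).factorial : ℝ)) := by
    rw [Nat.cast_choose ℝ hkn]
    field_simp
  simp only [eval_mul, eval_C, eval_pow, eval_X]
  set P := (descPochhammer ℝ (n - k)).eval ((n : ℝ) + α)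
  calc (-1) ^ k / (k.factorial : ℝ) * (P / ((n - k).factorial : ℝ)) * x ^ k
      = (1 / ((k.factorial : ℝ) * ((n - k).factorial : ℝ))) * ((-1) ^ k * P * x ^ k) := by
        field_simp
    _ = (Real.exp x * Real.exp (-x)) * (x ^ (-α) * x ^ α) *
          ((n.choose k : ℝ) / (n.factorial : ℝ)) * ((-1) ^ k * P * x ^ k) := by
        rw [hexp, hxa, hch]; ring
    _ = _ := by ring

/-- A partition of length `k`: a weakly decreasing sequence of `k` positive integers. -/
def IsPartition {k : ℕ} (p : Fin k → ℕ) : Prop :=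
  Antitone p ∧ ∀ i, 0 < p i

/-- The weight `|p|`, the sum of the parts. -/
def weight {k : ℕ} (p : Fin k → ℕ) : ℕ := ∑ i, p i

/-- The degrees `p_j + k - j`, `j = 1, …, k`, attached to `p` (here `j = i + 1`). -/
def degreeOf {k : ℕ} (p : Fin k → ℕ) (i : Fin k) : ℕ := p i + (k - (i.val + 1))

/-- The Wronskian of `f₁, …, f_k` at `x`: the determinant of `(d^(j-1) f_i / dx^(j-1))`. -/
noncomputable def wronskian {k : ℕ} (f : Fin k → ℝ → ℝ) (x : ℝ) : ℝ :=
  (Matrix.of fun i j : Fin k => iteratedDeriv j.val (f i) x).det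

/-- The functions `L_{n_1}^(α)(x), …, L_{n_{r₁}}^(α)(x)`, then
`eˣ L_{m_1}^(α)(-x), …, eˣ L_{m_{r₂}}^(α)(-x)`, then `L_s^(α)(x)`. -/
noncomputable def seedFunctions (α : ℝ) {r₁ r₂ : ℕ} (lam : Fin r₁ → ℕ) (mu : Fin r₂ → ℕ)
    (s : ℕ) : Fin (r₁ + r₂ + 1) → ℝ → ℝ :=
  Fin.snoc
    (Fin.append (fun i x => (laguerre α (degreeOf lam i)).eval x)
      (fun i x => Real.exp x * (laguerre α (degreeOf mu i)).eval (-x)))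
    (fun x => (laguerre α s).eval x)

/-- The set of degrees `ℕ_{lam,mu}`: all `n ≥ |lam| + |mu| - r₁` such that
`n - |lam| - |mu| ≠ lam_j - j` for `j = 1, …, r₁` (here `j = i + 1`). -/
def degreeSequence {r₁ r₂ : ℕ} (lam : Fin r₁ → ℕ) (mu : Fin r₂ → ℕ) : Set ℕ :=
  {n | (weight lam : ℤ) + weight mu - r₁ ≤ n ∧
    ∀ i : Fin r₁, (n : ℤ) - weight lam - weight mu ≠ (lam i : ℤ) - (i.val + 1)}

/-- `s = n - |lam| - |mu| + r₁`; no truncation occurs for `n` in the degree sequence. -/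
def lastDegree {r₁ r₂ : ℕ} (lam : Fin r₁ → ℕ) (mu : Fin r₂ → ℕ) (n : ℕ) : ℕ :=
  n + r₁ - (weight lam + weight mu)

/-- Row `j ↦ Dʲ p` of the Wronskian determinant of a polynomial `p`. -/
noncomputable def polyRow (p : ℝ[X]) (j : ℕ) : ℝ[X] := derivative^[j] p

/-- Row `j ↦ (1 + D)ʲ p = e^(-x) Dʲ (eˣ p)`. -/
noncomputable def expRow (p : ℝ[X]) (j : ℕ) : ℝ[X] := (fun q => q + derivative q)^[j] p

/-- The exceptional Laguerre polynomial `e^(-r₂ x) Wr[f₁, …, f_r, L_s^(α)]` as a polynomial: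
the factor `eˣ` is taken out of each of the `r₂` rows of the determinant that carry it.
See `eval_exceptionalLaguerre` for the formula with the Wronskian. -/
noncomputable def exceptionalLaguerre (α : ℝ) {r₁ r₂ : ℕ} (lam : Fin r₁ → ℕ) (mu : Fin r₂ → ℕ)
    (n : ℕ) : ℝ[X] :=
  (Matrix.of fun i j : Fin (r₁ + r₂ + 1) =>
    (Fin.snoc (α := fun _ => ℕ → ℝ[X])
      (Fin.append (fun i => polyRow (laguerre α (degreeOf lam i)))
        (fun i => expRow ((laguerre α (degreeOf mu i)).comp (-X))))
      (polyRow (laguerre α (lastDegree lam mu n))) : Fin (r₁ + r₂ + 1) → ℕ → ℝ[X]) i j.val).det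

theorem iteratedDeriv_polyRow (p : ℝ[X]) (j : ℕ) :
    iteratedDeriv j (fun x => p.eval x) = fun x => (polyRow p j).eval x := by
  induction j generalizing p with
  | zero => simp [polyRow]
  | succ j ih =>
    rw [iteratedDeriv_succ']
    have : deriv (fun x => p.eval x) = fun x => (derivative p).eval x := by
      ext x; simp
    rw [this, ih]
    simp [polyRow]

theorem iteratedDeriv_expRow (p : ℝ[X]) (j : ℕ) :
    iteratedDeriv j (fun x => Real.exp x * p.eval x)
      = fun x => Real.exp x * (expRow p j).eval x := by
  induction j generalizing p with
  | zero => simp [expRow]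
  | succ j ih =>
    rw [iteratedDeriv_succ']
    have : deriv (fun x => Real.exp x * p.eval x)
        = fun x => Real.exp x * (p + derivative p).eval x := by
      ext x
      have := ((Real.hasDerivAt_exp x).mul (p.hasDerivAt x)).deriv
      rw [show (fun x => Real.exp x * p.eval x) = Real.exp * (fun x => p.eval x) from rfl, this]
      simp; ring
    rw [this, ih]
    simp [expRow]

/-- The defining formula `e^(-r₂ x) Wr[f₁, …, f_r, L_s^(α)](x)`. -/
theorem eval_exceptionalLaguerre (α : ℝ) {r₁ r₂ : ℕ} (lam : Fin r₁ → ℕ) (mu : Fin r₂ → ℕ)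
    (n : ℕ) (x : ℝ) :
    (exceptionalLaguerre α lam mu n).eval x = Real.exp (-((r₂ : ℝ) * x)) *
      wronskian (seedFunctions α lam mu (lastDegree lam mu n)) x := by
  set R : Fin (r₁ + r₂ + 1) → ℕ → ℝ[X] := Fin.snoc (α := fun _ => ℕ → ℝ[X])
      (Fin.append (fun i => polyRow (laguerre α (degreeOf lam i)))
        (fun i => expRow ((laguerre α (degreeOf mu i)).comp (-X))))
      (polyRow (laguerre α (lastDegree lam mu n))) with hR
  set c : Fin (r₁ + r₂ + 1) → ℝ := Fin.snoc (α := fun _ => ℝ)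
      (Fin.append (fun _ => 1) (fun _ => Real.exp x)) 1 with hc
  have hentry : ∀ (i : Fin (r₁ + r₂ + 1)) (j : ℕ),
      iteratedDeriv j (seedFunctions α lam mu (lastDegree lam mu n) i) x
        = c i * (R i j).eval x := by
    intro i j
    refine Fin.lastCases ?_ (fun i => ?_) i
    · simp [seedFunctions, hc, hR, iteratedDeriv_polyRow]
    · refine Fin.addCases (fun i => ?_) (fun i => ?_) i
      · simp [seedFunctions, hc, hR, iteratedDeriv_polyRow]
      · have := congrFun (iteratedDeriv_expRow ((laguerre α (degreeOf mu i)).comp (-X)) j) x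
        simpa [seedFunctions, hc, hR, -Fin.castSucc_natAdd] using this
  have hprod : ∏ i, c i = Real.exp ((r₂ : ℝ) * x) := by
    rw [Fin.prod_univ_castSucc, Fin.prod_univ_add]
    simp [hc, Real.exp_nat_mul, -Fin.castSucc_natAdd]
  have hdet : wronskian (seedFunctions α lam mu (lastDegree lam mu n)) x
      = (∏ i, c i) * (Matrix.of fun i j : Fin (r₁ + r₂ + 1) => (R i j.val).eval x).det := by
    rw [← Matrix.det_mul_column]
    simp only [wronskian, hentry]
    rfl
  have heval : (exceptionalLaguerre α lam mu n).eval x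
      = (Matrix.of fun i j : Fin (r₁ + r₂ + 1) => (R i j.val).eval x).det := by
    rw [exceptionalLaguerre, ← Polynomial.coe_evalRingHom, RingHom.map_det]
    rfl
  rw [heval, hdet, hprod, ← mul_assoc, ← Real.exp_add]
  simp

/-- The regular zeros: the zeros in `(0, ∞)`, listed with multiplicity. -/
noncomputable def regularZeros (α : ℝ) {r₁ r₂ : ℕ} (lam : Fin r₁ → ℕ) (mu : Fin r₂ → ℕ)
    (n : ℕ) : Multiset ℝ :=
  open Classical in (exceptionalLaguerre α lam mu n).roots.filter (fun x => 0 < x)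

/-- `N(n)`, the number of regular zeros, counted with multiplicity. -/
noncomputable def numRegularZeros (α : ℝ) {r₁ r₂ : ℕ} (lam : Fin r₁ → ℕ) (mu : Fin r₂ → ℕ)
    (n : ℕ) : ℕ :=
  Multiset.card (regularZeros α lam mu n)

end XLaguerre

/-! ### Laguerre polynomials: differential equation and orthogonality. -/

namespace XLaguerre

open Polynomial MeasureTheory

/-! Write `P` for the exceptional polynomial and `s` for its last degree. The regular zeros of `P`
are compared, up to boundedly many, with the zeros of an ordinary Laguerre polynomial of parameter
`α + r`, for which the limit law comes from moments.

Comparison. Only one row of the determinant depends on `n`, so `P = ∑ⱼ Qⱼ Dʲ L_s` with fixed `Qⱼ`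
(`exists_exceptionalLaguerre_eq_sum`). Each `Dʲ L_s` with `j ≤ r` is orthogonal to low degrees for
the weight `x^(α+r) e^(-x)`, integrable since `α + r > -1` (`orthBelow_iterate_derivative`). Hence,
for a constant `d`, `P` has degree at most `s + d` and is orthogonal to all degrees below `s - d`.
Take the Gauss quadrature at the `s + d` zeros of `L_{s+d}^(α+r)`. If `P` changed sign fewer than `s
- d` times along the nodes, some `q` of degree below `s - d` would match its signs there, and the
quadrature would make the vanishing integral of `P q` positive. So at least `s - d` zeros of `P`
interlace with nodes (`OrthBelow.exists_interlacing`), and sums of a test function over the zeros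
and over the nodes differ by a bounded amount. This needs `P ≠ 0`, which is
`det_twistedRow_ne_zero`.

Limit law. The Stieltjes relations for the zeros of a Laguerre polynomial give a quadratic recursion
for power sums (`sum_pow_succ_eq`); rescaled, it becomes the Catalan recursion, and the Catalan
numbers are the moments of the limit density (`mpIntegral_pow`). A few zeros of `P` could be far
away, so the comparison uses bounded test functions, polynomials in `min x 5`. Weierstrass
approximation and a cutoff near `0` then reach every bounded continuous `f`. -/

theorem laguerre_coeff (α : ℝ) (n k : ℕ) : (laguerre α n).coeff k =
    if k ≤ n then (-1) ^ k / (k.factorial : ℝ) *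
      ((descPochhammer ℝ (n - k)).eval ((n : ℝ) + α) / ((n - k).factorial : ℝ)) else 0 := by
  rw [laguerre, finsetSum_coeff]
  simp only [coeff_C_mul, coeff_X_pow]
  simp

theorem laguerre_coeff_self_ne_zero (α : ℝ) (n : ℕ) : (laguerre α n).coeff n ≠ 0 := by
  simp [laguerre_coeff, Nat.factorial_ne_zero]

theorem laguerre_ne_zero (α : ℝ) (n : ℕ) : laguerre α n ≠ 0 := fun h =>
  laguerre_coeff_self_ne_zero α n (by simp [h])

theorem natDegree_laguerre (α : ℝ) (n : ℕ) : (laguerre α n).natDegree = n := by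
  refine natDegree_eq_of_le_of_coeff_ne_zero ?_ (laguerre_coeff_self_ne_zero α n)
  refine natDegree_le_iff_coeff_eq_zero.2 fun N hN => ?_
  simp [laguerre_coeff, Nat.not_le.2 hN]

/-- The Laguerre differential equation `x y'' + (β + 1 - x) y' + ν y = 0`. -/
def SatisfiesODE (β ν : ℝ) (y : ℝ[X]) : Prop :=
  X * derivative (derivative y) + (C (β + 1) - X) * derivative y + C ν * y = 0

theorem SatisfiesODE.eq {β ν : ℝ} {y : ℝ[X]} (h : SatisfiesODE β ν y) :
    X * derivative (derivative y) + (C (β + 1) - X) * derivative y + C ν * y = 0 := h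

theorem satisfiesODE_laguerre (α : ℝ) (n : ℕ) : SatisfiesODE α n (laguerre α n) := by
  have hrec : ∀ k : ℕ, ((k : ℝ) + 1) * (k + 1 + α) * (laguerre α n).coeff (k + 1)
      = -((n : ℝ) - k) * (laguerre α n).coeff k := by
    intro k
    rw [laguerre_coeff, laguerre_coeff]
    rcases lt_trichotomy k n with h | h | h
    · obtain ⟨m, rfl⟩ : ∃ m, n = k + 1 + m := ⟨n - (k + 1), by omega⟩
      rw [if_pos (by omega), if_pos (by omega), show k + 1 + m - (k + 1) = m by omega,
        show k + 1 + m - k = m + 1 by omega, descPochhammer_succ_eval, Nat.factorial_succ,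
        Nat.factorial_succ, pow_succ]
      push_cast
      have h1 : (k.factorial : ℝ) ≠ 0 := by positivity
      have h2 : (m.factorial : ℝ) ≠ 0 := by positivity
      have h3 : (k : ℝ) + 1 ≠ 0 := by positivity
      have h4 : (m : ℝ) + 1 ≠ 0 := by positivity
      field_simp
      ring
    · subst h; simp
    · rw [if_neg (by omega), if_neg (by omega)]; simp
  ext k
  cases k with
  | zero =>
    have := hrec 0
    simp only [sub_mul, coeff_add, coeff_sub, coeff_C_zero, coeff_derivative, mul_coeff_zero,
      coeff_X_zero, coeff_zero] at this ⊢
    push_cast at this ⊢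
    linarith
  | succ k =>
    have := hrec (k + 1)
    simp only [sub_mul, coeff_add, coeff_sub, coeff_X_mul, coeff_C_mul, coeff_derivative,
      coeff_zero] at this ⊢
    push_cast at this ⊢
    linear_combination this

theorem SatisfiesODE.derivative {β ν : ℝ} {y : ℝ[X]} (h : SatisfiesODE β ν y) :
    SatisfiesODE (β + 1) (ν - 1) (derivative y) := by
  have := congrArg Polynomial.derivative h
  simp only [SatisfiesODE, derivative_add, derivative_mul, derivative_X, derivative_sub,
    derivative_C, derivative_one, map_zero, C_add, C_sub, C_1] at this ⊢
  linear_combination this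

theorem SatisfiesODE.iterate_derivative {β ν : ℝ} {y : ℝ[X]} (h : SatisfiesODE β ν y) (j : ℕ) :
    SatisfiesODE (β + j) (ν - j) (Polynomial.derivative^[j] y) := by
  induction j with
  | zero => simpa using h
  | succ j ih =>
    rw [Function.iterate_succ_apply']
    have := ih.derivative
    push_cast
    rwa [← add_assoc, ← sub_sub]

theorem integrableOn_gammaWeight {β : ℝ} (hβ : -1 < β) (p : ℝ[X]) :
    IntegrableOn (fun x => p.eval x * (Real.exp (-x) * x ^ β)) (Set.Ioi 0) := by
  induction p using Polynomial.induction_on' with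
  | add p q hp hq =>
    simp only [eval_add, add_mul]
    exact Integrable.add hp hq
  | monomial m c =>
    have hs : 0 < β + m + 1 := by
      have : (0 : ℝ) ≤ m := m.cast_nonneg
      linarith
    have : IntegrableOn (fun x => c * (Real.exp (-x) * x ^ (β + m + 1 - 1))) (Set.Ioi 0) :=
      (Real.GammaIntegral_convergent hs).const_mul c
    refine this.congr_fun (fun x hx => ?_) measurableSet_Ioi
    simp only [eval_monomial]
    rw [add_sub_cancel_right, Real.rpow_add hx, Real.rpow_natCast]
    ring

/-- The moment functional `q ↦ ∫₀^∞ q(x) x^β e^(-x) dx` of the Laguerre weight. -/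
noncomputable def gammaFunctional {β : ℝ} (hβ : -1 < β) : ℝ[X] →ₗ[ℝ] ℝ where
  toFun p := ∫ x in Set.Ioi (0 : ℝ), p.eval x * (Real.exp (-x) * x ^ β)
  map_add' p q := by
    simp only [eval_add, add_mul]
    exact integral_add (integrableOn_gammaWeight hβ p) (integrableOn_gammaWeight hβ q)
  map_smul' c p := by
    simp only [eval_smul, smul_eq_mul, mul_assoc, RingHom.id_apply]
    exact integral_const_mul _ _

theorem gammaFunctional_monomial {β : ℝ} (hβ : -1 < β) (m : ℕ) (c : ℝ) :
    gammaFunctional hβ (monomial m c) = c * Real.Gamma (β + m + 1) := by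
  have hs : 0 < β + m + 1 := by
      have : (0 : ℝ) ≤ m := m.cast_nonneg
      linarith
  rw [Real.Gamma_eq_integral hs, ← integral_const_mul]
  refine setIntegral_congr_fun measurableSet_Ioi fun x hx => ?_
  simp only [eval_monomial]
  rw [add_sub_cancel_right, Real.rpow_add hx, Real.rpow_natCast]
  ring

/-- A linear functional on polynomials which is positive on nonzero polynomials that are
nonnegative on `(0, ∞)`. -/
def PositiveOnHalfLine (Λ : ℝ[X] →ₗ[ℝ] ℝ) : Prop :=
  ∀ p : ℝ[X], p ≠ 0 → (∀ x, 0 < x → 0 ≤ p.eval x) → 0 < Λ p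

theorem gammaFunctional_pos {β : ℝ} (hβ : -1 < β) : PositiveOnHalfLine (gammaFunctional hβ) := by
  intro p hp hnn
  have hw : ∀ x : ℝ, 0 < x → 0 < Real.exp (-x) * x ^ β := fun x hx => by positivity
  change 0 < ∫ x in Set.Ioi (0 : ℝ), p.eval x * (Real.exp (-x) * x ^ β)
  rw [setIntegral_pos_iff_support_of_nonneg_ae
    ((ae_restrict_iff' measurableSet_Ioi).2 (.of_forall fun x hx =>
      mul_nonneg (hnn x hx) (hw x hx).le)) (integrableOn_gammaWeight hβ p)]
  have hsub : Set.Ioi (0 : ℝ) \ (p.roots.toFinset : Set ℝ) ⊆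
      Function.support (fun x => p.eval x * (Real.exp (-x) * x ^ β)) ∩ Set.Ioi 0 := by
    intro x hx
    refine ⟨mul_ne_zero (fun h => hx.2 ?_) (hw x hx.1).ne', hx.1⟩
    simp [hp, h]
  refine lt_of_lt_of_le ?_ (measure_mono hsub)
  rw [measure_sdiff_null (Finset.measure_zero _ _)]
  simp

/-- Integration by parts for the Laguerre weight. -/
def IntegrationByParts (β : ℝ) (Λ : ℝ[X] →ₗ[ℝ] ℝ) : Prop :=
  ∀ q : ℝ[X], Λ (X * derivative q + (C (β + 1) - X) * q) = 0

theorem gammaFunctional_integrationByParts {β : ℝ} (hβ : -1 < β) :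
    IntegrationByParts β (gammaFunctional hβ) := by
  intro q
  induction q using Polynomial.induction_on' with
  | add p q hp hq =>
    rw [← add_zero (0 : ℝ)]
    nth_rw 1 [← hp]
    rw [← hq, ← map_add]
    rw [derivative_add]
    congr 1
    ring
  | monomial m c =>
    have hs : 0 < β + m + 1 := by
      have : (0 : ℝ) ≤ m := m.cast_nonneg
      linarith
    have h : X * derivative (monomial m c) + (C (β + 1) - X) * monomial m c
        = monomial m ((β + m + 1) * c) - monomial (m + 1) c := by
      rw [sub_mul, C_mul_monomial, X_mul_monomial, derivative_monomial]
      cases m with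
      | zero => simp
      | succ m =>
        rw [X_mul_monomial, Nat.add_sub_cancel, add_sub, ← map_add]
        congr 2
        push_cast; ring
    rw [h, map_sub, gammaFunctional_monomial, gammaFunctional_monomial]
    have := Real.Gamma_add_one hs.ne'
    push_cast
    rw [← add_assoc β, this]
    ring

/-- `u` is `Λ`-orthogonal to all polynomials of degree less than `k`. -/
def OrthBelow (Λ : ℝ[X] →ₗ[ℝ] ℝ) (u : ℝ[X]) (k : ℕ) : Prop :=
  ∀ q : ℝ[X], q.natDegree < k → Λ (u * q) = 0

theorem orthBelow_of_X_pow {Λ : ℝ[X] →ₗ[ℝ] ℝ} {u : ℝ[X]} {k : ℕ}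
    (h : ∀ m < k, Λ (u * X ^ m) = 0) : OrthBelow Λ u k := by
  intro q hq
  rw [q.as_sum_range_C_mul_X_pow, Finset.mul_sum, map_sum]
  refine Finset.sum_eq_zero fun m hm => ?_
  rw [show u * (C (q.coeff m) * X ^ m) = q.coeff m • (u * X ^ m) by
    rw [smul_eq_C_mul]; ring, map_smul, h m, smul_zero]
  have := Finset.mem_range.1 hm
  omega

/-- The operator `x D² + (β + 1 - x) D` is symmetric. -/
theorem IntegrationByParts.symm {β : ℝ} {Λ : ℝ[X] →ₗ[ℝ] ℝ} (hΛ : IntegrationByParts β Λ)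
    (a b : ℝ[X]) :
    Λ ((X * derivative (derivative a) + (C (β + 1) - X) * derivative a) * b)
      = Λ (a * (X * derivative (derivative b) + (C (β + 1) - X) * derivative b)) := by
  have h1 := hΛ (derivative a * b)
  have h2 := hΛ (a * derivative b)
  rw [← sub_eq_zero, ← map_sub]
  rw [← sub_eq_zero.2 (h1.trans h2.symm), ← map_sub]
  congr 1
  simp only [derivative_mul]
  ring

/-- The symmetric operator `x D² + (β + 1 - x) D` has `u` as an eigenvector for `-n`, and is
triangular on powers, with diagonal entry `-m` at `X ^ m`. Since `m ≠ n` for `m < n`, induction on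
`m` gives orthogonality to each power. -/
theorem orthBelow_of_satisfiesODE {β : ℝ} {Λ : ℝ[X] →ₗ[ℝ] ℝ} (hΛ : IntegrationByParts β Λ)
    {n : ℕ} {u : ℝ[X]} (hu : SatisfiesODE β n u) : OrthBelow Λ u n := by
  refine orthBelow_of_X_pow fun m => ?_
  induction m with
  | zero =>
    intro h0
    have h := hΛ.symm u 1
    rw [show X * derivative (derivative u) + (C (β + 1) - X) * derivative u = (-(n : ℝ)) • u by
      rw [smul_eq_C_mul, C_neg]; linear_combination hu.eq] at h
    have hn : (n : ℝ) ≠ 0 := by positivity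
    simpa [hn] using h
  | succ m ih =>
    intro hm
    have h := hΛ.symm u (X ^ (m + 1))
    rw [show X * derivative (derivative u) + (C (β + 1) - X) * derivative u = (-(n : ℝ)) • u by
      rw [smul_eq_C_mul, C_neg]; linear_combination hu.eq] at h
    have h3 : u * (X * derivative (derivative (X ^ (m + 1))) +
        (C (β + 1) - X) * derivative (X ^ (m + 1))) =
        (((m : ℝ) + 1) * (m + β + 1)) • (u * X ^ m) - ((m : ℝ) + 1) • (u * X ^ (m + 1)) := by
      simp only [derivative_X_pow, smul_eq_C_mul, derivative_mul, derivative_C]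
      cases m with
      | zero => simp; ring
      | succ m => simp; ring
    rw [h3, map_sub, map_smul, map_smul, ih (by omega), smul_mul_assoc, map_smul] at h
    have hn : (n : ℝ) - (m + 1) ≠ 0 := by
      have : ((m + 1 : ℕ) : ℝ) < n := by exact_mod_cast hm
      push_cast at this
      linarith
    simp only [smul_eq_mul] at h
    refine (mul_eq_zero.1 (?_ : ((n : ℝ) - (m + 1)) * _ = 0)).resolve_left hn
    linear_combination -h

/-- Derivatives of a Laguerre polynomial with parameter `α` are orthogonal to polynomials of low
degree with respect to the weight with parameter `α + r`. -/
theorem orthBelow_iterate_derivative {α : ℝ} {r s : ℕ} {Λ : ℝ[X] →ₗ[ℝ] ℝ}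
    (hΛ : IntegrationByParts (α + r) Λ) {y : ℝ[X]} (hy : SatisfiesODE α s y) (i : ℕ) (hi : i ≤ r) :
    OrthBelow Λ (derivative^[r - i] y) (s - r - i) := by
  induction i using Nat.strong_induction_on with
  | _ i ih =>
    intro q hq
    have hode := hy.iterate_derivative (r - i)
    rcases Nat.eq_zero_or_pos i with rfl | hpos
    · have hrs : r ≤ s := by omega
      rw [Nat.sub_zero, ← Nat.cast_sub hrs] at hode
      exact orthBelow_of_satisfiesODE hΛ hode q (by simpa using hq)
    -- A degree below the truncated difference `s - r - i` exists only if `s > r + i`, so the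
    -- differential equation can be solved for `u`. This trades `u` for `u'` and `u''`, whose
    -- cofactors have degree at most one more than `q`; decreasing `i` pays for that.
    have hν : (s : ℝ) - ((r - i : ℕ) : ℝ) ≠ 0 := by
      have : ((r - i : ℕ) : ℝ) < s := by exact_mod_cast (by omega : r - i < s)
      linarith
    set u := derivative^[r - i] y with hu
    set c := α + ((r - i : ℕ) : ℝ) + 1
    have hu1 : derivative u = derivative^[r - (i - 1)] y := by
      rw [hu, ← Function.iterate_succ_apply' (f := ⇑derivative)]
      congr 2; omega
    have key : Λ (u * q) * ((s : ℝ) - ((r - i : ℕ) : ℝ)) =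
        - (Λ (derivative (derivative u) * (X * q)) + Λ (derivative u * ((C c - X) * q))) := by
      rw [mul_comm, ← smul_eq_mul, ← map_smul, ← map_add, ← map_neg]
      congr 1
      rw [smul_eq_C_mul]
      linear_combination q * hode.eq
    have hd1 : ((C c - X) * q).natDegree ≤ 1 + q.natDegree :=
      natDegree_mul_le_of_le (by compute_degree) le_rfl
    have hdX : (X * q).natDegree ≤ 1 + q.natDegree :=
      natDegree_mul_le_of_le (by compute_degree) le_rfl
    have h1 : Λ (derivative u * ((C c - X) * q)) = 0 := by
      rw [hu1]
      exact ih (i - 1) (by omega) (by omega) _ (by omega)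
    have h2 : Λ (derivative (derivative u) * (X * q)) = 0 := by
      rcases Nat.lt_or_ge 1 i with h | h
      · have hu2 : derivative (derivative u) = derivative^[r - (i - 2)] y := by
          rw [hu1, ← Function.iterate_succ_apply' (f := ⇑derivative)]
          congr 2; omega
        rw [hu2]
        exact ih (i - 2) (by omega) (by omega) _ (by omega)
      -- Here `u''` is the derivative of order `r + 1`, outside the induction, so integration by
      -- parts moves one derivative onto the cofactor.
      · have hi1 : i = 1 := by omega
        have := hΛ (derivative u * q)
        rw [show X * derivative (derivative u * q) + (C (α + r + 1) - X) * (derivative u * q)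
          = derivative (derivative u) * (X * q) +
            derivative u * (X * derivative q + (C (α + r + 1) - X) * q) by
            rw [derivative_mul]; ring, map_add] at this
        rw [← this, left_eq_add, hu1]
        refine ih (i - 1) (by omega) (by omega) _ ?_
        have : (X * derivative q + (C (α + r + 1) - X) * q).natDegree ≤ 1 + q.natDegree := by
          refine natDegree_add_le_of_degree_le ?_ ?_
          · exact natDegree_mul_le_of_le (by compute_degree)
              ((natDegree_derivative_le q).trans (Nat.sub_le _ _))
          · exact natDegree_mul_le_of_le (by compute_degree) le_rfl
        omega
    rw [h1, h2, add_zero, neg_zero] at key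
    exact (mul_eq_zero.1 key).resolve_right hν

end XLaguerre

/-! ### Real zeros, Gauss quadrature and interlacing. -/

namespace XLaguerre

open Polynomial

theorem pos_or_neg_of_roots_eq_zero {g : ℝ[X]} (hg : g ≠ 0) (h : g.roots = 0) :
    (∀ x, 0 < g.eval x) ∨ ∀ x, g.eval x < 0 := by
  by_contra! hcon
  obtain ⟨⟨x, hx⟩, y, hy⟩ := hcon
  obtain ⟨z, hz⟩ := intermediate_value_univ x y g.continuous ⟨hx, hy⟩
  have : z ∈ g.roots := (mem_roots hg).2 hz
  simp [h] at this

/-- A nonzero polynomial orthogonal to all polynomials of degree less than `k` has at least `k`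
positive roots. -/
theorem OrthBelow.le_card_pos_roots {Λ : ℝ[X] →ₗ[ℝ] ℝ} (hpos : PositiveOnHalfLine Λ) {p : ℝ[X]}
    (hp : p ≠ 0) {k : ℕ} (h : OrthBelow Λ p k) :
    k ≤ (p.roots.toFinset.filter (0 < ·)).card := by
  classical
  obtain ⟨g, hpg, -, hg⟩ := p.exists_prod_multiset_X_sub_C_mul
  have hg0 : g ≠ 0 := by
    rintro rfl
    exact hp (by rw [← hpg, mul_zero])
  -- These are the positive points where `p` changes sign; multiplying by one more factor at each
  -- gives a polynomial of constant sign on the half line.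
  set S := p.roots.toFinset.filter (fun a => 0 < a ∧ Odd (p.roots.count a)) with hS
  set q : ℝ[X] := ∏ a ∈ S, (X - C a) with hq
  have hqdeg : q.natDegree = S.card := by
    rw [hq, natDegree_prod_of_monic _ _ fun a _ => monic_X_sub_C a]
    simp
  have hq0 : q ≠ 0 := (monic_prod_of_monic _ _ fun a _ => monic_X_sub_C a).ne_zero
  have hle : S.card ≤ (p.roots.toFinset.filter (0 < ·)).card :=
    Finset.card_le_card fun a ha => by
      simp only [hS, Finset.mem_filter] at ha ⊢
      exact ⟨ha.1, ha.2.1⟩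
  refine le_trans ?_ hle
  by_contra! hlt
  have hΛ : Λ (p * q) = 0 := h q (hqdeg ▸ hlt)
  have hnn : ∀ x, 0 < x → 0 ≤ ((p.roots.map fun a => X - C a).prod * q).eval x := by
    intro x hx
    rw [Finset.prod_multiset_map_count, hq, hS, Finset.prod_filter, ← Finset.prod_mul_distrib,
      eval_prod]
    refine Finset.prod_nonneg fun a _ => ?_
    by_cases h1 : 0 < a ∧ Odd (p.roots.count a)
    · rw [if_pos h1, ← pow_succ, eval_pow]
      exact h1.2.add_one.pow_nonneg _
    · rw [if_neg h1, mul_one, eval_pow]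
      by_cases h2 : 0 < a
      · exact (Nat.not_odd_iff_even.1 fun h3 => h1 ⟨h2, h3⟩).pow_nonneg _
      · refine pow_nonneg ?_ _
        simp only [eval_sub, eval_X, eval_C]
        linarith
  have hsplit : ∀ x, (p * q).eval x =
      ((p.roots.map fun a => X - C a).prod * q).eval x * g.eval x := by
    intro x
    conv_lhs => rw [← hpg]
    simp only [eval_mul]
    ring
  rcases pos_or_neg_of_roots_eq_zero hg0 hg with hs | hs
  · refine (hpos (p * q) (mul_ne_zero hp hq0) fun x hx => ?_).ne' hΛ
    rw [hsplit]
    exact mul_nonneg (hnn x hx) (hs x).le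
  · refine (hpos (-(p * q)) (neg_ne_zero.2 (mul_ne_zero hp hq0)) fun x hx => ?_).ne' ?_
    · rw [eval_neg, hsplit]
      have := mul_nonneg (hnn x hx) (neg_nonneg.2 (hs x).le)
      linarith
    · rw [map_neg, hΛ, neg_zero]

/-- A polynomial of degree `K` orthogonal to all polynomials of smaller degree is a multiple of
the nodal polynomial of `K` distinct positive points. -/
theorem OrthBelow.exists_nodal {Λ : ℝ[X] →ₗ[ℝ] ℝ} (hpos : PositiveOnHalfLine Λ) {p : ℝ[X]}
    (hp : p ≠ 0) (h : OrthBelow Λ p p.natDegree) :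
    ∃ S : Finset ℝ, S.card = p.natDegree ∧ (∀ x ∈ S, 0 < x) ∧
      p = C p.leadingCoeff * Lagrange.nodal S id := by
  classical
  set S := p.roots.toFinset.filter (0 < ·)
  have hS : p.natDegree ≤ S.card := h.le_card_pos_roots hpos hp
  have hle : S.val ≤ p.roots := by
    rw [Multiset.le_iff_subset S.nodup]
    intro x hx
    exact Multiset.mem_toFinset.1 (Finset.mem_filter.1 hx).1
  have hroots : S.val = p.roots :=
    Multiset.eq_of_le_of_card_le hle (le_trans p.card_roots' hS)
  have hcard : Multiset.card p.roots = p.natDegree :=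
    le_antisymm p.card_roots' (by rw [← hroots]; exact hS)
  refine ⟨S, by rw [← hcard, ← hroots]; rfl, fun x hx => (Finset.mem_filter.1 hx).2, ?_⟩
  conv_lhs => rw [← C_leadingCoeff_mul_prod_multiset_X_sub_C hcard, ← hroots]
  rfl

/-- Gauss quadrature. -/
theorem exists_gauss_quadrature {Λ : ℝ[X] →ₗ[ℝ] ℝ} (hpos : PositiveOnHalfLine Λ) {S : Finset ℝ}
    (h : OrthBelow Λ (Lagrange.nodal S id) S.card) :
    ∃ w : ℝ → ℝ, (∀ x ∈ S, 0 < w x) ∧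
      ∀ q : ℝ[X], q.natDegree < 2 * S.card → Λ q = ∑ x ∈ S, w x * q.eval x := by
  classical
  have hinj : Set.InjOn (id : ℝ → ℝ) S := Set.injOn_id _
  have hmonic : (Lagrange.nodal S (id : ℝ → ℝ)).Monic := Lagrange.nodal_monic
  have hdeg : (Lagrange.nodal S (id : ℝ → ℝ)).natDegree = S.card := by simp
  have key : ∀ q : ℝ[X], q.natDegree < 2 * S.card →
      Λ q = ∑ x ∈ S, Λ (Lagrange.basis S id x) * q.eval x := by
    intro q hq
    set d := q /ₘ Lagrange.nodal S id
    set e := q %ₘ Lagrange.nodal S id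
    have hqe : e + Lagrange.nodal S id * d = q := modByMonic_add_div q _
    have hd : d.natDegree < S.card := by
      rw [natDegree_divByMonic q hmonic, hdeg]
      omega
    have hedeg : e.degree < S.card := by
      have := degree_modByMonic_lt q hmonic
      rwa [Lagrange.degree_nodal] at this
    have heval : ∀ x ∈ S, q.eval x = e.eval x := by
      intro x hx
      rw [← hqe, eval_add, eval_mul]
      have : (Lagrange.nodal S (id : ℝ → ℝ)).eval x = 0 := Lagrange.eval_nodal_at_node (v := id) hx
      rw [this, zero_mul, add_zero]
    have hint : e = Lagrange.interpolate S id fun x => e.eval x :=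
      Lagrange.eq_interpolate hinj hedeg
    have hΛ : Λ q = Λ e := by rw [← hqe, map_add, h d hd, add_zero]
    rw [hΛ, hint, Lagrange.interpolate_apply, map_sum]
    refine Finset.sum_congr rfl fun x hx => ?_
    rw [← smul_eq_C_mul, map_smul, heval x hx, smul_eq_mul, mul_comm]
  refine ⟨fun x => Λ (Lagrange.basis S id x), fun a ha => ?_, key⟩
  have hb0 : Lagrange.basis S id a ≠ 0 := Lagrange.basis_ne_zero hinj ha
  have hcard : 0 < S.card := Finset.card_pos.2 ⟨a, ha⟩
  have hbdeg : (Lagrange.basis S id a).natDegree = S.card - 1 :=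
    natDegree_eq_of_degree_eq_some (Lagrange.degree_basis hinj ha)
  have h1 := key (Lagrange.basis S id a * Lagrange.basis S id a)
    (lt_of_le_of_lt natDegree_mul_le (by omega))
  have h2 := hpos _ (mul_ne_zero hb0 hb0) fun x _ => by
    rw [eval_mul]; exact mul_self_nonneg _
  rw [h1, Finset.sum_eq_single_of_mem a ha] at h2
  · have : (Lagrange.basis S id a).eval (id a) = 1 := Lagrange.eval_basis_self hinj ha
    rw [id] at this
    simpa [this] using h2
  · intro b hb hba
    have : (Lagrange.basis S id a).eval (id b) = 0 :=
      Lagrange.eval_basis_of_ne (v := (id : ℝ → ℝ)) hba.symm hb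
    simp only [id] at this
    simp [this]

/-- The sign changes of `P` along the finite set `T`: a polynomial `q` of degree `m` has the signs
of `P` on `T`, and `P` has `m` zeros interlacing with points of `T`. -/
theorem exists_interlacing (P : ℝ[X]) (T : Finset ℝ) (hT : ∃ x ∈ T, P.eval x ≠ 0) :
    ∃ (q : ℝ[X]) (Y Z : Finset ℝ) (a t : ℝ), a ∈ T ∧ t ∈ T ∧ a ≤ t ∧
      q.natDegree ≤ Y.card ∧ Z.card = Y.card ∧ Y ⊆ T ∧ (∀ y ∈ Y, y ≤ t) ∧
      (∀ z ∈ Z, P.eval z = 0 ∧ a < z ∧ z < t) ∧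
      (∀ x ∈ T, 0 ≤ P.eval x * q.eval x) ∧ (∀ x, t ≤ x → 0 < P.eval t * q.eval x) ∧
      ∀ g φ : ℝ → ℝ, (∀ x y, 0 < x → x ≤ y → φ x ≤ φ y ∧ |g x - g y| ≤ φ y - φ x) → 0 < a →
        |∑ z ∈ Z, g z - ∑ y ∈ Y, g y| ≤ φ t - φ a := by
  classical
  induction T using Finset.induction_on_max with
  | empty => simp at hT
  | insert b T hb ih =>
    by_cases hT' : ∃ x ∈ T, P.eval x ≠ 0
    · obtain ⟨q, Y, Z, a, t, haT, htT, hat, hq, hZY, hYT, hYt, hZ, hnn, hpos, hg⟩ := ih hT'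
      have htb : t < b := hb t htT
      have hqb : 0 < P.eval t * q.eval b := hpos b htb.le
      rcases le_or_gt 0 (P.eval b * P.eval t) with hs | hs
      · refine ⟨q, Y, Z, a, t, Finset.mem_insert_of_mem haT, Finset.mem_insert_of_mem htT, hat, hq,
          hZY, hYT.trans (Finset.subset_insert _ _), hYt, hZ, ?_, hpos, hg⟩
        intro x hx
        rcases Finset.mem_insert.1 hx with rfl | hx
        · have h1 : P.eval t ^ 2 * (P.eval x * q.eval x) =
              (P.eval x * P.eval t) * (P.eval t * q.eval x) := by ring
          have h2 : 0 < P.eval t ^ 2 := by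
            have : P.eval t ≠ 0 := left_ne_zero_of_mul hqb.ne'
            positivity
          by_contra! h3
          have := mul_neg_of_pos_of_neg h2 h3
          have := mul_nonneg hs hqb.le
          linarith
        · exact hnn x hx
      -- A sign change occurs between `t` and `b`. The factor `ξ - X` flips the sign of `q` at `b`
      -- without altering it on `T`, and the new zero `ζ` of `P` is paired with the node `b`.
      · obtain ⟨ξ, hξT, hξb⟩ : ∃ ξ, (∀ x ∈ T, x < ξ) ∧ ξ < b := by
          have hne : T.Nonempty := ⟨t, htT⟩
          obtain ⟨ξ, h1, h2⟩ := exists_between (hb _ (T.max'_mem hne))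
          exact ⟨ξ, fun x hx => (T.le_max' x hx).trans_lt h1, h2⟩
        obtain ⟨ζ, ⟨htζ, hζb⟩, hζ⟩ : ∃ ζ ∈ Set.Ioo t b, P.eval ζ = 0 := by
          rcases mul_neg_iff.1 hs with ⟨h1, h2⟩ | ⟨h1, h2⟩
          · exact intermediate_value_Ioo htb.le P.continuous.continuousOn ⟨h2, h1⟩
          · exact intermediate_value_Ioo' htb.le P.continuous.continuousOn ⟨h1, h2⟩
        have hbY : b ∉ Y := fun h => (hb b (hYT h)).false
        have hζZ : ζ ∉ Z := fun h => absurd (hZ ζ h).2.2 htζ.not_gt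
        have hpos' : ∀ x, b ≤ x → 0 < P.eval b * (q * (C ξ - X)).eval x := by
          intro x hx
          have h1 := hpos x (htb.le.trans hx)
          have h2 : P.eval t ^ 2 * (P.eval b * (q * (C ξ - X)).eval x) =
              (P.eval b * P.eval t) * (P.eval t * q.eval x) * (ξ - x) := by
            simp only [eval_mul, eval_sub, eval_C, eval_X]; ring
          have h3 : 0 < (P.eval b * P.eval t) * (P.eval t * q.eval x) * (ξ - x) :=
            mul_pos_of_neg_of_neg (mul_neg_of_neg_of_pos hs h1) (by linarith)
          rw [← h2] at h3
          exact pos_of_mul_pos_right h3 (sq_nonneg _)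
        refine ⟨q * (C ξ - X), insert b Y, insert ζ Z, a, b, Finset.mem_insert_of_mem haT,
          Finset.mem_insert_self _ _, hat.trans htb.le, ?_, ?_, ?_, ?_, ?_, ?_, hpos', ?_⟩
        · rw [Finset.card_insert_of_notMem hbY]
          exact natDegree_mul_le_of_le hq (by compute_degree)
        · rw [Finset.card_insert_of_notMem hbY, Finset.card_insert_of_notMem hζZ, hZY]
        · exact Finset.insert_subset_insert _ hYT
        · intro y hy
          rcases Finset.mem_insert.1 hy with rfl | hy
          · exact le_rfl
          · exact (hYt y hy).trans htb.le
        · intro z hz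
          rcases Finset.mem_insert.1 hz with rfl | hz
          · exact ⟨hζ, hat.trans_lt htζ, hζb⟩
          · exact ⟨(hZ z hz).1, (hZ z hz).2.1, (hZ z hz).2.2.trans htb⟩
        · intro x hx
          rcases Finset.mem_insert.1 hx with rfl | hx
          · exact (hpos' x le_rfl).le
          · simp only [eval_mul, eval_sub, eval_C, eval_X]
            rw [← mul_assoc]
            exact mul_nonneg (hnn x hx) (sub_nonneg.2 (hξT x hx).le)
        -- The pairs lie in successive disjoint intervals, so the bounds by increments of the
        -- monotone `φ` telescope.
        · intro g φ hgφ ha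
          rw [Finset.sum_insert hbY, Finset.sum_insert hζZ]
          have h1 := hg g φ hgφ ha
          have h2 := (hgφ ζ b ((ha.trans_le hat).trans htζ) hζb.le).2
          have h3 := (hgφ t ζ (ha.trans_le hat) htζ.le).1
          rw [abs_le] at h1 h2 ⊢
          constructor <;> linarith [h1.1, h1.2, h2.1, h2.2]
    · push Not at hT'
      have hPb : P.eval b ≠ 0 := by
        obtain ⟨x, hx, hx0⟩ := hT
        rcases Finset.mem_insert.1 hx with rfl | hx
        · exact hx0
        · exact absurd (hT' x hx) hx0
      refine ⟨C (P.eval b), ∅, ∅, b, b, Finset.mem_insert_self _ _, Finset.mem_insert_self _ _,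
        le_rfl, by simp, rfl, by simp, by simp, by simp, ?_, ?_, ?_⟩
      · intro x hx
        rcases Finset.mem_insert.1 hx with rfl | hx
        · simp [mul_self_nonneg]
        · simp [hT' x hx]
      · intro x _
        rw [eval_C]
        exact mul_self_pos.2 hPb
      · simp

/-- Zeros of a polynomial orthogonal to low degrees interlace, up to boundedly many exceptions,
with the nodes of a Gauss quadrature. -/
theorem OrthBelow.exists_interlacing {Λ : ℝ[X] →ₗ[ℝ] ℝ} (hpos : PositiveOnHalfLine Λ)
    {S : Finset ℝ} (hS0 : ∀ x ∈ S, 0 < x) (hS : OrthBelow Λ (Lagrange.nodal S id) S.card)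
    {P : ℝ[X]} (hdeg : P.natDegree ≤ S.card) {k : ℕ} (h : OrthBelow Λ P k)
    (hk : k ≤ S.card) :
    ∃ (Y Z : Finset ℝ), k ≤ Y.card ∧ Z.card = Y.card ∧ Y ⊆ S ∧
      (∀ z ∈ Z, P.eval z = 0 ∧ 0 < z) ∧
      ∀ g φ : ℝ → ℝ, (∀ x y, 0 < x → x ≤ y → φ x ≤ φ y ∧ |g x - g y| ≤ φ y - φ x) →
        (∀ x, 0 < x → 0 ≤ φ x) → ∀ M, (∀ x, 0 < x → φ x ≤ M) → 0 ≤ M →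
        |∑ z ∈ Z, g z - ∑ y ∈ Y, g y| ≤ M := by
  classical
  by_cases hne : ∃ x ∈ S, P.eval x ≠ 0
  · obtain ⟨q, Y, Z, a, t, haS, htS, hat, hq, hZY, hYS, -, hZ, hnn, hposq, hg⟩ :=
      XLaguerre.exists_interlacing P S hne
    obtain ⟨w, hw, hquad⟩ := exists_gauss_quadrature hpos hS
    have ha0 := hS0 a haS
    refine ⟨Y, Z, ?_, hZY, hYS, fun z hz => ⟨(hZ z hz).1, ha0.trans (hZ z hz).2.1⟩, ?_⟩
    -- Otherwise `q` has degree below `k`, so `Λ (P * q) = 0` by orthogonality, while the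
    -- quadrature, exact in this degree, gives a sum of nonnegative terms with a positive one at
    -- `t`.
    · by_contra! hlt
      have h1 := hquad (P * q) (lt_of_le_of_lt natDegree_mul_le (by omega))
      rw [h q (by omega)] at h1
      have h2 : 0 < ∑ x ∈ S, w x * (P * q).eval x := by
        refine Finset.sum_pos' (fun x hx => ?_) ⟨t, htS, ?_⟩
        · rw [eval_mul]
          exact mul_nonneg (hw x hx).le (hnn x hx)
        · rw [eval_mul]
          exact mul_pos (hw t htS) (hposq t le_rfl)
      linarith
    · intro g φ hgφ hφ M hM _
      have := hg g φ hgφ ha0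
      linarith [hφ a ha0, hM t (hS0 t htS)]
  · push Not at hne
    refine ⟨S, S, hk, rfl, subset_rfl, fun z hz => ⟨hne z hz, hS0 z hz⟩, ?_⟩
    intro g φ _ _ M _ hM
    simpa using hM

end XLaguerre

/-! ### Nonvanishing of the Wronskian and orthogonality of the exceptional polynomials. -/

namespace XLaguerre

open Polynomial

theorem coeff_X_mul_derivative (p : ℝ[X]) (n : ℕ) :
    (X * derivative p).coeff n = n * p.coeff n := by
  cases n with
  | zero => simp
  | succ n => rw [coeff_X_mul, coeff_derivative]; push_cast; ring

theorem natDegree_X_mul_derivative_le (p : ℝ[X]) : (X * derivative p).natDegree ≤ p.natDegree :=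
  natDegree_le_iff_coeff_eq_zero.2 fun n hn => by
    rw [coeff_X_mul_derivative, coeff_eq_zero_of_natDegree_lt hn, mul_zero]

/-- The hypothesis says `(a / W)' = 0`. Subtract the multiple of `W` that kills the coefficient of
`a` in degree `deg W`. If the remainder `b` were nonzero, comparing top coefficients after applying
`X D` would force `deg b = deg W`, a contradiction. -/
theorem exists_eq_C_mul_of_mul_derivative_eq {W a : ℝ[X]} (hW : W ≠ 0)
    (h : W * derivative a = derivative W * a) : ∃ c, a = C c * W := by
  refine ⟨a.coeff W.natDegree / W.leadingCoeff, ?_⟩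
  set c := a.coeff W.natDegree / W.leadingCoeff with hc
  have hlc : W.leadingCoeff ≠ 0 := leadingCoeff_ne_zero.2 hW
  set b := a - C c * W with hb
  have hbd : b.coeff W.natDegree = 0 := by
    rw [hb, coeff_sub, coeff_C_mul, coeff_natDegree, hc, div_mul_cancel₀ _ hlc, sub_self]
  have hWb : W * (X * derivative b) = (X * derivative W) * b := by
    simp only [hb, derivative_sub, derivative_C_mul]
    linear_combination X * h
  by_contra hne
  have hb0 : b ≠ 0 := fun h0 => hne (sub_eq_zero.1 h0)
  have hcoef := congrArg (fun p => p.coeff (W.natDegree + b.natDegree)) hWb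
  rw [coeff_mul_add_eq_of_natDegree_le le_rfl (natDegree_X_mul_derivative_le b),
    coeff_mul_add_eq_of_natDegree_le (natDegree_X_mul_derivative_le W) le_rfl, coeff_X_mul_derivative,
    coeff_X_mul_derivative, coeff_natDegree, coeff_natDegree] at hcoef
  have hlb : b.leadingCoeff ≠ 0 := leadingCoeff_ne_zero.2 hb0
  have hd : (b.natDegree : ℝ) = W.natDegree := by
    refine mul_right_cancel₀ (mul_ne_zero hlc hlb) ?_
    linear_combination hcoef
  rw [← Nat.cast_injective hd] at hbd
  exact hlb hbd

/-- The equation reads `(a / W)' = δ (a / W)`, which has no nonzero rational solution: after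
multiplication by `X` the right side has larger degree than the left. -/
theorem eq_zero_of_mul_derivative_sub_eq {W a : ℝ[X]} (hW : W ≠ 0) {δ : ℝ} (hδ : δ ≠ 0)
    (h : W * derivative a - derivative W * a = C δ * (W * a)) : a = 0 := by
  by_contra ha
  have h1 : W * (X * derivative a) - (X * derivative W) * a = C δ * X * (W * a) := by
    linear_combination X * h
  have h2 : (W * (X * derivative a) - (X * derivative W) * a).natDegree
      ≤ W.natDegree + a.natDegree :=
    (natDegree_sub_le_of_le
      (natDegree_mul_le_of_le le_rfl (natDegree_X_mul_derivative_le a))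
      (natDegree_mul_le_of_le (natDegree_X_mul_derivative_le W) le_rfl)).trans (max_self _).le
  rw [h1, natDegree_mul (mul_ne_zero (C_ne_zero.2 hδ) X_ne_zero) (mul_ne_zero hW ha),
    natDegree_C_mul_X _ hδ, natDegree_mul hW ha] at h2
  omega

/-- Row `j ↦ (D + ε)ʲ p = e^(-ε x) Dʲ (e^(ε x) p)`. -/
noncomputable def twistedRow (ε : ℝ) (p : ℝ[X]) (j : ℕ) : ℝ[X] :=
  (fun q => C ε * q + derivative q)^[j] p

theorem derivative_twistedRow (ε : ℝ) (p : ℝ[X]) (j : ℕ) :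
    derivative (twistedRow ε p j) = twistedRow ε p (j + 1) - C ε * twistedRow ε p j := by
  rw [twistedRow, twistedRow, Function.iterate_succ_apply']
  ring

theorem twistedRow_zero (p : ℝ[X]) (j : ℕ) : twistedRow 0 p j = polyRow p j := by
  simp only [twistedRow, polyRow, C_0, zero_mul, zero_add]

theorem twistedRow_one (p : ℝ[X]) (j : ℕ) : twistedRow 1 p j = expRow p j := by
  simp only [twistedRow, expRow, C_1, one_mul]

/-- The Wronskian of functions `e^(ε x) p(x)` with distinct pairs `(ε, deg p)` does not vanish. -/
theorem det_twistedRow_ne_zero {k : ℕ} (ε : Fin k → ℝ) (p : Fin k → ℝ[X]) (hp : ∀ i, p i ≠ 0)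
    (hinj : ∀ i j, i ≠ j → ε i = ε j → (p i).natDegree ≠ (p j).natDegree) :
    (Matrix.of fun i j : Fin k => twistedRow (ε i) (p i) j.val).det ≠ 0 := by
  induction k with
  | zero => simp
  | succ k ih =>
    have hminor := ih (fun i => ε i.castSucc) (fun i => p i.castSucc) (fun i => hp _)
      (fun i j hij => hinj _ _ fun h => hij (Fin.castSucc_injective _ h))
    have hker : ∀ u : Fin (k + 1) → ℝ[X], u (Fin.last k) = 0 →
        (∀ j : Fin k, ∑ i, u i * twistedRow (ε i) (p i) j.val = 0) → u = 0 := by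
      intro u hu h
      have h0 : (fun i : Fin k => u i.castSucc) = 0 := by
        refine Matrix.eq_zero_of_vecMul_eq_zero hminor ?_
        ext1 j
        have := h j
        rw [Fin.sum_univ_castSucc, hu, zero_mul, add_zero] at this
        simpa [Matrix.vecMul, dotProduct] using this
      ext1 i
      refine Fin.lastCases hu (fun i => congrFun h0 i) i
    intro hdet
    obtain ⟨v, hv, hvM⟩ := Matrix.exists_vecMul_eq_zero_iff.2 hdet
    have hrel : ∀ j : ℕ, j < k + 1 → ∑ i, v i * twistedRow (ε i) (p i) j = 0 := by
      intro j hj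
      have := congrFun hvM ⟨j, hj⟩
      simpa [Matrix.vecMul, dotProduct] using this
    set W := v (Fin.last k) with hWdef
    have hW : W ≠ 0 := fun h => hv (hker v h fun j => hrel j (by omega))
    -- Differentiating the row relation yields another one, valid on the first `k` columns, whose
    -- last coefficient vanishes; the nonzero minor makes it trivial. So each `v i / W` solves a
    -- first-order equation and is a constant, zero unless `ε i` equals the last `ε`. The column `j
    -- = 0` then gives a linear relation among polynomials of distinct degrees.
    have hzero := hker (fun i => W * derivative (v i) - derivative W * v i -
        C (ε i - ε (Fin.last k)) * (W * v i)) (by simp [hWdef, mul_comm]) fun j => by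
      have h1 := hrel j (by omega)
      have h2 := hrel (j + 1) (by omega)
      have h3 := congrArg derivative h1
      simp only [derivative_sum, derivative_mul, derivative_twistedRow, map_zero] at h3
      have h4 : ∑ i, (W * derivative (v i) - derivative W * v i -
          C (ε i - ε (Fin.last k)) * (W * v i)) * twistedRow (ε i) (p i) j =
          W * (∑ i, (derivative (v i) * twistedRow (ε i) (p i) j +
            v i * (twistedRow (ε i) (p i) (j + 1) - C (ε i) * twistedRow (ε i) (p i) j)))
          - W * (∑ i, v i * twistedRow (ε i) (p i) (j + 1))
          - (derivative W - C (ε (Fin.last k)) * W) * ∑ i, v i * twistedRow (ε i) (p i) j := by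
        rw [Finset.mul_sum, Finset.mul_sum, Finset.mul_sum, ← Finset.sum_sub_distrib,
          ← Finset.sum_sub_distrib]
        refine Finset.sum_congr rfl fun i _ => ?_
        rw [C_sub]
        ring
      rw [h4, h1, h2, h3]
      simp
    have hc : ∀ i, ∃ c, v i = C c * W ∧ (c ≠ 0 → ε i = ε (Fin.last k)) := by
      intro i
      have hi := congrFun hzero i
      simp only [Pi.zero_apply] at hi
      by_cases hε : ε i = ε (Fin.last k)
      · rw [hε, sub_self, C_0, zero_mul, sub_zero, sub_eq_zero] at hi
        obtain ⟨c, hc⟩ := exists_eq_C_mul_of_mul_derivative_eq hW hi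
        exact ⟨c, hc, fun _ => hε⟩
      · refine ⟨0, ?_, fun h => absurd rfl h⟩
        rw [C_0, zero_mul]
        exact eq_zero_of_mul_derivative_sub_eq hW (sub_ne_zero.2 hε) (sub_eq_zero.1 hi)
    choose c hcv hcε using hc
    have hclast : c (Fin.last k) ≠ 0 := by
      intro h
      have := hcv (Fin.last k)
      rw [h, C_0, zero_mul] at this
      exact hW this
    have hsum : ∑ i, C (c i) * p i = 0 := by
      refine (mul_eq_zero.1 (?_ : W * _ = 0)).resolve_left hW
      rw [← hrel 0 (by omega), Finset.mul_sum]
      refine Finset.sum_congr rfl fun i _ => ?_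
      rw [hcv i, twistedRow, Function.iterate_zero, id]
      ring
    have hdeg := degree_sum_eq_of_disjoint (fun i => C (c i) * p i) Finset.univ (by
      intro i hi j hj hij
      have hci : c i ≠ 0 := fun h => hi.2 (by simp [h])
      have hcj : c j ≠ 0 := fun h => hj.2 (by simp [h])
      have := hinj i j hij ((hcε i hci).trans (hcε j hcj).symm)
      simp only [Function.onFun, Function.comp, degree_C_mul hci, degree_C_mul hcj]
      rw [degree_eq_natDegree (hp i), degree_eq_natDegree (hp j)]
      exact_mod_cast this)
    rw [hsum, degree_zero] at hdeg
    have hle : (C (c (Fin.last k)) * p (Fin.last k)).degree ≤ ⊥ := by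
      rw [hdeg]
      exact Finset.le_sup (f := fun i => (C (c i) * p i).degree) (Finset.mem_univ (Fin.last k))
    rw [degree_C_mul hclast, le_bot_iff, degree_eq_bot] at hle
    exact hp _ hle

theorem degreeOf_injective {k : ℕ} {p : Fin k → ℕ} (hp : IsPartition p) :
    Function.Injective (degreeOf p) := by
  have h : StrictAnti (degreeOf p) := by
    intro i j hij
    have h1 := hp.1 hij.le
    have h2 := j.isLt
    have h3 : i.val < j.val := hij
    simp only [degreeOf]
    omega
  exact h.injective

theorem natDegree_laguerre_comp_neg (α : ℝ) (n : ℕ) :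
    ((laguerre α n).comp (-X)).natDegree = n := by
  rw [natDegree_comp, natDegree_neg, natDegree_X, mul_one, natDegree_laguerre]

theorem laguerre_comp_neg_ne_zero (α : ℝ) (n : ℕ) : (laguerre α n).comp (-X) ≠ 0 := by
  intro h
  have h1 : ((laguerre α n).comp (-X)).comp (-X) = laguerre α n := by simp [comp_assoc]
  rw [h, zero_comp] at h1
  exact laguerre_ne_zero α n h1.symm

theorem exceptionalLaguerre_ne_zero (α : ℝ) {r₁ r₂ : ℕ} {lam : Fin r₁ → ℕ} {mu : Fin r₂ → ℕ}
    (hlam : IsPartition lam) (hmu : IsPartition mu) {n : ℕ}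
    (hn : ∀ i, degreeOf lam i ≠ lastDegree lam mu n) :
    exceptionalLaguerre α lam mu n ≠ 0 := by
  set ε : Fin (r₁ + r₂ + 1) → ℝ := Fin.snoc (α := fun _ => ℝ)
    (Fin.append (fun _ => 0) (fun _ => 1)) 0 with hε
  set p : Fin (r₁ + r₂ + 1) → ℝ[X] := Fin.snoc (α := fun _ => ℝ[X])
    (Fin.append (fun i => laguerre α (degreeOf lam i))
      (fun i => (laguerre α (degreeOf mu i)).comp (-X)))
    (laguerre α (lastDegree lam mu n)) with hp
  have h := det_twistedRow_ne_zero ε p ?_ ?_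
  · rw [exceptionalLaguerre]
    convert h using 2
    refine congrArg _ ?_
    funext i j
    refine Fin.lastCases ?_ (fun i => ?_) i
    · simp [hε, hp, twistedRow_zero]
    · refine Fin.addCases (fun i => ?_) (fun i => ?_) i
      · simp [hε, hp, twistedRow_zero]
      · simp [hε, hp, twistedRow_one, -Fin.castSucc_natAdd]
  · intro i
    refine Fin.lastCases ?_ (fun i => ?_) i
    · simp [hp, laguerre_ne_zero]
    · refine Fin.addCases (fun i => ?_) (fun i => ?_) i
      · simp [hp, laguerre_ne_zero]
      · simp only [hp, Fin.snoc_castSucc, Fin.append_right]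
        exact laguerre_comp_neg_ne_zero α _
  · intro i j
    refine Fin.lastCases ?_ (fun i => ?_) i <;> refine Fin.lastCases ?_ (fun j => ?_) j
    · simp
    · refine Fin.addCases (fun j => ?_) (fun j => ?_) j
      · simpa [hp, hε, natDegree_laguerre] using fun _ => (hn j).symm
      · simp [hp, hε, -Fin.castSucc_natAdd]
    · refine Fin.addCases (fun i => ?_) (fun i => ?_) i
      · simpa [hp, hε, natDegree_laguerre] using hn i
      · simp [hp, hε, -Fin.castSucc_natAdd]
    · refine Fin.addCases (fun i => ?_) (fun i => ?_) i <;>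
        refine Fin.addCases (fun j => ?_) (fun j => ?_) j
      · simp only [hp, hε, Fin.snoc_castSucc, Fin.append_left, natDegree_laguerre]
        intro hij _ h
        exact hij (by rw [degreeOf_injective hlam h])
      · simp [hε, -Fin.castSucc_natAdd]
      · simp [hε, -Fin.castSucc_natAdd]
      · simp only [hp, hε, Fin.snoc_castSucc, Fin.append_right, natDegree_laguerre_comp_neg]
        intro hij _ h
        exact hij (by rw [degreeOf_injective hmu h])

theorem exists_exceptionalLaguerre_eq_sum (α : ℝ) {r₁ r₂ : ℕ} (lam : Fin r₁ → ℕ)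
    (mu : Fin r₂ → ℕ) : ∃ Q : Fin (r₁ + r₂ + 1) → ℝ[X], ∀ n, exceptionalLaguerre α lam mu n =
      ∑ j, derivative^[j.val] (laguerre α (lastDegree lam mu n)) * Q j := by
  refine ⟨fun j => (-1) ^ ((Fin.last (r₁ + r₂)).val + j.val) *
    (Matrix.of fun a b : Fin (r₁ + r₂) =>
      (Fin.append (fun i => polyRow (laguerre α (degreeOf lam i)))
        (fun i => expRow ((laguerre α (degreeOf mu i)).comp (-X))) : Fin (r₁ + r₂) → ℕ → ℝ[X]) a
        (j.succAbove b).val).det, fun n => ?_⟩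
  rw [exceptionalLaguerre, Matrix.det_succ_row _ (Fin.last (r₁ + r₂))]
  refine Finset.sum_congr rfl fun j _ => ?_
  rw [Matrix.of_apply, Fin.snoc_last, polyRow]
  rw [mul_comm _ (derivative^[j.val] _), mul_assoc]
  refine congrArg _ (congrArg _ (congrArg Matrix.det ?_))
  ext1 a b
  simp [Matrix.submatrix]

/-- The exceptional Laguerre polynomials satisfy the orthogonality relations of a Laguerre
polynomial up to a bounded shift of degrees. -/
theorem exists_orthBelow_exceptionalLaguerre (α : ℝ) {r₁ r₂ : ℕ} (lam : Fin r₁ → ℕ)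
    (mu : Fin r₂ → ℕ) {Λ : ℝ[X] →ₗ[ℝ] ℝ}
    (hΛ : IntegrationByParts (α + ((r₁ + r₂ : ℕ) : ℝ)) Λ) :
    ∃ d : ℕ, ∀ n, (exceptionalLaguerre α lam mu n).natDegree ≤ lastDegree lam mu n + d ∧
      OrthBelow Λ (exceptionalLaguerre α lam mu n) (lastDegree lam mu n - d) := by
  obtain ⟨Q, hQ⟩ := exists_exceptionalLaguerre_eq_sum α lam mu
  set e := Finset.univ.sup fun j => (Q j).natDegree with he
  have hle : ∀ j, (Q j).natDegree ≤ e := fun j =>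
    Finset.le_sup (f := fun j => (Q j).natDegree) (Finset.mem_univ j)
  -- With `r = r₁ + r₂`, the derivative of order `j = r - i` is orthogonal below `s - r - i ≥ s - 2
  -- r`, and the factor `Q j` costs at most `e` more.
  refine ⟨e + 2 * (r₁ + r₂), fun n => ⟨?_, fun q hq => ?_⟩⟩
  · rw [hQ]
    refine natDegree_sum_le_of_forall_le _ _ fun j _ => ?_
    refine natDegree_mul_le.trans ?_
    have h1 := natDegree_iterate_derivative (laguerre α (lastDegree lam mu n)) j.val
    rw [natDegree_laguerre] at h1
    have := hle j
    omega
  · rw [hQ, Finset.sum_mul, map_sum]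
    refine Finset.sum_eq_zero fun j _ => ?_
    have hj := j.isLt
    have := orthBelow_iterate_derivative hΛ (satisfiesODE_laguerre α (lastDegree lam mu n))
      (r₁ + r₂ - j.val) (by omega)
    rw [show r₁ + r₂ - (r₁ + r₂ - j.val) = j.val by omega] at this
    rw [mul_assoc]
    refine this _ ?_
    have h1 : (Q j * q).natDegree ≤ (Q j).natDegree + q.natDegree := natDegree_mul_le
    have := hle j
    omega

end XLaguerre

/-! ### Power sums of Laguerre zeros. -/

namespace XLaguerre

open Polynomial Filter Topology

/-- The Stieltjes relations for the zeros of a solution of the Laguerre equation. -/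
theorem sum_two_mul_div_sub {β ν : ℝ} {S : Finset ℝ}
    (h : SatisfiesODE β ν (Lagrange.nodal S id)) {a : ℝ} (ha : a ∈ S) :
    ∑ b ∈ S, 2 * a / (a - b) = a - (β + 1) := by
  set g := Lagrange.nodal (S.erase a) (id : ℝ → ℝ) with hg
  have hS : Lagrange.nodal S (id : ℝ → ℝ) = (X - C a) * g :=
    Lagrange.nodal_eq_mul_nodal_erase (v := id) ha
  have hga : g.eval a ≠ 0 := by
    rw [hg, Lagrange.eval_nodal, Finset.prod_ne_zero_iff]
    intro b hb
    exact sub_ne_zero.2 (Finset.ne_of_mem_erase hb).symm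
  have hg' : (derivative g).eval a = ∑ b ∈ S.erase a, g.eval a / (a - b) := by
    rw [hg, Lagrange.derivative_nodal, eval_finsetSum]
    refine Finset.sum_congr rfl fun b hb => ?_
    rw [Lagrange.nodal_eq_mul_nodal_erase (v := (id : ℝ → ℝ)) hb, eval_mul]
    have : a - b ≠ 0 := sub_ne_zero.2 (Finset.ne_of_mem_erase hb).symm
    simp only [eval_sub, eval_X, eval_C, id]
    field_simp
  have hode := congrArg (eval a) h.eq
  rw [hS] at hode
  simp only [derivative_mul, derivative_sub, derivative_add, derivative_X, derivative_C,
    derivative_one, derivative_zero, eval_add, eval_sub, eval_mul, eval_X, eval_C, eval_zero, eval_one, hg'] at hode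
  -- The diagonal term `b = a` contributes `0`, since division by zero is zero.
  rw [← Finset.add_sum_erase S _ ha, sub_self, div_zero, zero_add]
  refine mul_left_cancel₀ hga ?_
  have h1 : g.eval a * ∑ b ∈ S.erase a, 2 * a / (a - b) =
      2 * a * ∑ b ∈ S.erase a, g.eval a / (a - b) := by
    rw [Finset.mul_sum, Finset.mul_sum]
    exact Finset.sum_congr rfl fun b _ => by ring
  rw [h1]
  linear_combination hode

/-- Multiply the Stieltjes relation at `a` by `a ^ p`, sum over `a` and symmetrise in `a` and `b`:
the quotient `(a ^ (p + 1) - b ^ (p + 1)) / (a - b)` is a geometric sum. On the diagonal that sum is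
`(p + 1) a ^ p` instead of `0`, whence the correction from `β + 1` to `β - p`. -/
theorem sum_pow_succ_eq {β ν : ℝ} {S : Finset ℝ}
    (h : SatisfiesODE β ν (Lagrange.nodal S id)) (p : ℕ) :
    ∑ x ∈ S, x ^ (p + 1) =
      ∑ i ∈ Finset.range (p + 1), (∑ x ∈ S, x ^ i) * (∑ x ∈ S, x ^ (p - i))
        + (β - p) * ∑ x ∈ S, x ^ p := by
  classical
  have h1 : ∑ a ∈ S, a ^ p * (a - (β + 1)) = ∑ a ∈ S, ∑ b ∈ S, 2 * (a ^ (p + 1) / (a - b)) := by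
    refine Finset.sum_congr rfl fun a ha => ?_
    rw [← sum_two_mul_div_sub h ha, Finset.mul_sum]
    exact Finset.sum_congr rfl fun b _ => by ring
  have h2 : ∑ a ∈ S, ∑ b ∈ S, 2 * (a ^ (p + 1) / (a - b)) =
      ∑ a ∈ S, ∑ b ∈ S, (a ^ (p + 1) / (a - b) + b ^ (p + 1) / (b - a)) := by
    simp only [two_mul, Finset.sum_add_distrib]
    congr 1
    exact Finset.sum_comm
  have h3 : ∀ a b : ℝ, a ^ (p + 1) / (a - b) + b ^ (p + 1) / (b - a) =
      ∑ i ∈ Finset.range (p + 1), a ^ i * b ^ (p - i) - if a = b then ((p : ℝ) + 1) * a ^ p else 0 := by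
    intro a b
    by_cases hab : a = b
    · subst hab
      have : ∀ i ∈ Finset.range (p + 1), a ^ i * a ^ (p - i) = a ^ p := fun i hi => by
        rw [← pow_add, Nat.add_sub_cancel' (Nat.lt_succ_iff.1 (Finset.mem_range.1 hi))]
      simp [Finset.sum_congr rfl this]
    · have hne : a - b ≠ 0 := sub_ne_zero.2 hab
      have := geom_sum₂_mul a b (p + 1)
      simp only [Nat.add_sub_cancel] at this
      rw [if_neg hab, sub_zero, ← neg_sub a b, div_neg, ← sub_eq_add_neg, ← sub_div, ← this,
        mul_div_cancel_right₀ _ hne]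
  have h4 : ∑ a ∈ S, ∑ b ∈ S, ∑ i ∈ Finset.range (p + 1), a ^ i * b ^ (p - i) =
      ∑ i ∈ Finset.range (p + 1), (∑ x ∈ S, x ^ i) * (∑ x ∈ S, x ^ (p - i)) := by
    simp only [Finset.sum_mul_sum]
    refine Eq.symm (Finset.sum_comm.trans ?_)
    exact Finset.sum_congr rfl fun a _ => Finset.sum_comm
  rw [h2] at h1
  simp only [h3, Finset.sum_sub_distrib, h4] at h1
  have h5 : ∑ a ∈ S, ∑ b ∈ S, (if a = b then ((p : ℝ) + 1) * a ^ p else 0) =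
      ((p : ℝ) + 1) * ∑ x ∈ S, x ^ p := by
    rw [Finset.mul_sum]
    exact Finset.sum_congr rfl fun a ha => by simp [ha]
  have h6 : ∑ a ∈ S, a ^ p * (a - (β + 1)) =
      ∑ x ∈ S, x ^ (p + 1) - (β + 1) * ∑ x ∈ S, x ^ p := by
    rw [Finset.mul_sum, ← Finset.sum_sub_distrib]
    exact Finset.sum_congr rfl fun a _ => by ring
  rw [h5, h6] at h1
  linear_combination h1

/-- The moments of the rescaled zeros of Laguerre polynomials converge to the Catalan numbers. -/
theorem tendsto_sum_pow_div {β : ℝ} {S : ℕ → Finset ℝ} {ν N : ℕ → ℝ}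
    (h : ∀ᶠ n in atTop, SatisfiesODE β (ν n) (Lagrange.nodal (S n) id))
    (hN : Tendsto N atTop atTop) (hS : Tendsto (fun n => ((S n).card : ℝ) / N n) atTop (𝓝 1))
    (p : ℕ) :
    Tendsto (fun n => (∑ x ∈ S n, x ^ p) / N n ^ (p + 1)) atTop (𝓝 (catalan p)) := by
  induction p using Nat.strong_induction_on with
  | _ p ih =>
    cases p with
    | zero => simpa using hS
    | succ p =>
      have hlim : Tendsto (fun n => ∑ i ∈ Finset.range (p + 1),
          ((∑ x ∈ S n, x ^ i) / N n ^ (i + 1)) * ((∑ x ∈ S n, x ^ (p - i)) / N n ^ (p - i + 1))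
          + (β - p) * ((N n)⁻¹ * ((∑ x ∈ S n, x ^ p) / N n ^ (p + 1)))) atTop
          (𝓝 (∑ i ∈ Finset.range (p + 1), (catalan i : ℝ) * catalan (p - i)
            + (β - p) * (0 * catalan p))) := by
        refine (tendsto_finsetSum _ fun i hi => ?_).add
          ((hN.inv_tendsto_atTop.mul (ih p (by omega))).const_mul _)
        have := Finset.mem_range.1 hi
        exact (ih i (by omega)).mul (ih (p - i) (by omega))
      have hcat : (∑ i ∈ Finset.range (p + 1), (catalan i : ℝ) * catalan (p - i)
            + (β - p) * (0 * catalan p)) = catalan (p + 1) := by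
        rw [catalan_succ, Finset.sum_range]
        push_cast
        ring
      rw [hcat] at hlim
      refine hlim.congr' ?_
      filter_upwards [h, hN.eventually_gt_atTop 0] with n hn hpos
      symm
      rw [sum_pow_succ_eq hn p, add_div, Finset.sum_div]
      congr 1
      · refine Finset.sum_congr rfl fun i hi => ?_
        have := Finset.mem_range.1 hi
        rw [div_mul_div_comm, ← pow_add, show i + 1 + (p - i + 1) = p + 1 + 1 by omega]
      · field_simp
        ring

end XLaguerre

/-! ### Moments of the Marchenko–Pastur density. -/

namespace XLaguerre

open MeasureTheory intervalIntegral

theorem sqrt_div_eq {x : ℝ} (hx : x ∈ Set.Ioo (0 : ℝ) 4) :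
    0 < √(x * (4 - x)) ∧ √(x * (4 - x)) = x * √((4 - x) / x) ∧
      √(x * (4 - x)) * √((4 - x) / x) = 4 - x := by
  have h4 : 0 < 4 - x := by linarith [hx.2]
  have hx0 := hx.1
  have h1 : √(x * (4 - x)) = x * √((4 - x) / x) := by
    rw [Real.sqrt_eq_iff_mul_self_eq (by positivity) (by positivity), mul_mul_mul_comm,
      Real.mul_self_sqrt (by positivity)]
    field_simp
  refine ⟨by positivity, h1, ?_⟩
  rw [h1, mul_assoc, Real.mul_self_sqrt (by positivity)]
  field_simp

theorem hasDerivAt_sqrt_mul_sub {x : ℝ} (hx : x ∈ Set.Ioo (0 : ℝ) 4) :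
    HasDerivAt (fun x : ℝ => √(x * (4 - x))) ((2 - x) / √(x * (4 - x))) x := by
  have h4 : 0 < x * (4 - x) := mul_pos hx.1 (by linarith [hx.2])
  have h := ((hasDerivAt_id' x).fun_mul ((hasDerivAt_id' x).const_sub 4)).sqrt h4.ne'
  refine h.congr_deriv ?_
  have := (sqrt_div_eq hx).1
  field_simp
  ring

theorem hasDerivAt_marchenkoPastur {x : ℝ} (hx : x ∈ Set.Ioo (0 : ℝ) 4) :
    HasDerivAt (fun x : ℝ => 2 * Real.arcsin ((x - 2) / 2) + √(x * (4 - x)))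
      (√((4 - x) / x)) x := by
  obtain ⟨h1, -, h3⟩ := sqrt_div_eq hx
  have hsq : √(1 - ((x - 2) / 2) ^ 2) = √(x * (4 - x)) / 2 := by
    rw [show 1 - ((x - 2) / 2) ^ 2 = x * (4 - x) / 2 ^ 2 by ring, Real.sqrt_div' _ (by positivity),
      Real.sqrt_sq (by norm_num)]
  have ha := (Real.hasDerivAt_arcsin (x := (x - 2) / 2) (by linarith [hx.1])
    (by linarith [hx.2])).comp x (((hasDerivAt_id' x).sub_const 2).div_const 2)
  have h := (ha.const_mul 2).add (hasDerivAt_sqrt_mul_sub hx)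
  refine h.congr_deriv ?_
  rw [hsq]
  field_simp
  linear_combination -h3

theorem continuous_marchenkoPastur_primitive :
    Continuous (fun x : ℝ => 2 * Real.arcsin ((x - 2) / 2) + √(x * (4 - x))) := by
  have := Real.continuous_arcsin
  fun_prop

/-- The singularity at `0` is harmless because the density is the nonnegative derivative of a
function continuous up to the endpoints. -/
theorem intervalIntegrable_marchenkoPastur :
    IntervalIntegrable (fun x : ℝ => √((4 - x) / x)) volume 0 4 :=
  intervalIntegrable_deriv_of_nonneg continuous_marchenkoPastur_primitive.continuousOn
    (fun x hx => hasDerivAt_marchenkoPastur (by simpa using hx)) fun x _ => Real.sqrt_nonneg _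

theorem integral_marchenkoPastur : ∫ x in (0 : ℝ)..4, √((4 - x) / x) = 2 * Real.pi := by
  rw [integral_eq_sub_of_hasDerivAt_of_le (by norm_num)
    continuous_marchenkoPastur_primitive.continuousOn (fun x hx => hasDerivAt_marchenkoPastur hx)
    intervalIntegrable_marchenkoPastur]
  norm_num
  ring

theorem intervalIntegrable_mul_marchenkoPastur {h : ℝ → ℝ} (hh : ContinuousOn h (Set.Icc 0 4)) :
    IntervalIntegrable (fun x : ℝ => h x * √((4 - x) / x)) volume 0 4 :=
  intervalIntegrable_marchenkoPastur.continuousOn_mul (by simpa using hh)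

/-- Integrate the derivative of `x ^ p * (4 - x) * √(x * (4 - x))`, which vanishes at both
endpoints. The resulting recursion is that of the Catalan numbers. -/
theorem integral_pow_succ_mul_marchenkoPastur (p : ℕ) :
    (p + 2) * ∫ x in (0 : ℝ)..4, x ^ (p + 1) * √((4 - x) / x)
      = (4 * p + 2) * ∫ x in (0 : ℝ)..4, x ^ p * √((4 - x) / x) := by
  have hi : ∀ m : ℕ, IntervalIntegrable (fun x : ℝ => x ^ m * √((4 - x) / x)) volume 0 4 :=
    fun m => intervalIntegrable_mul_marchenkoPastur (by fun_prop)
  have hd : ∀ x ∈ Set.Ioo (0 : ℝ) 4, HasDerivAt (fun x : ℝ => x ^ p * (4 - x) * √(x * (4 - x)))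
      ((4 * p + 2) * (x ^ p * √((4 - x) / x)) - (p + 2) * (x ^ (p + 1) * √((4 - x) / x))) x := by
    intro x hx
    obtain ⟨h1, h2, h3⟩ := sqrt_div_eq hx
    have h := ((hasDerivAt_pow p x).fun_mul ((hasDerivAt_id' x).const_sub 4)).mul
      (hasDerivAt_sqrt_mul_sub hx)
    refine h.congr_deriv ?_
    have h4 : (4 - x) * ((2 - x) / √(x * (4 - x))) = (2 - x) * √((4 - x) / x) := by
      field_simp
      linear_combination -(2 - x) * h3
    have h5 : (p : ℝ) * x ^ (p - 1) * x = p * x ^ p := by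
      cases p with
      | zero => simp
      | succ p => rw [Nat.add_sub_cancel, pow_succ]; ring
    rw [mul_assoc (x ^ p), h4, h2, pow_succ]
    linear_combination ((4 - x) * √((4 - x) / x)) * h5
  have h := integral_eq_sub_of_hasDerivAt_of_le (by norm_num)
    (by fun_prop) hd (((hi p).const_mul _).sub ((hi (p + 1)).const_mul _))
  rw [integral_sub ((hi p).const_mul _) ((hi (p + 1)).const_mul _),
    intervalIntegral.integral_const_mul, intervalIntegral.integral_const_mul] at h
  norm_num at h
  linarith

theorem catalan_succ_mul (p : ℕ) :
    ((p : ℝ) + 2) * catalan (p + 1) = (4 * p + 2) * catalan p := by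
  have h1 := succ_mul_catalan_eq_centralBinom p
  have h2 := succ_mul_catalan_eq_centralBinom (p + 1)
  have h3 := Nat.succ_mul_centralBinom_succ p
  rw [← h1, ← h2] at h3
  have h4 : ((p : ℝ) + 1) * ((p + 1 + 1) * catalan (p + 1)) =
      2 * (2 * p + 1) * ((p + 1) * catalan p) := by exact_mod_cast h3
  have h5 : (p : ℝ) + 1 ≠ 0 := by positivity
  refine mul_left_cancel₀ h5 ?_
  linear_combination h4

theorem catalan_le_four_pow (p : ℕ) : (catalan p : ℝ) ≤ 4 ^ p := by
  induction p with
  | zero => simp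
  | succ p ih =>
    have h := catalan_succ_mul p
    have h1 : (0 : ℝ) ≤ catalan p := Nat.cast_nonneg _
    have h2 : ((p : ℝ) + 2) * catalan (p + 1) ≤ (p + 2) * 4 ^ (p + 1) := by
      rw [h, pow_succ]
      nlinarith
    exact le_of_mul_le_mul_left h2 (by positivity)

/-- Integration against the Marchenko–Pastur distribution on `[0, 4]`. -/
noncomputable def mpIntegral (h : ℝ → ℝ) : ℝ :=
  1 / (2 * Real.pi) * ∫ x in (0 : ℝ)..4, h x * √((4 - x) / x)

theorem mpIntegral_pow (p : ℕ) : mpIntegral (fun x => x ^ p) = catalan p := by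
  induction p with
  | zero =>
    simp [mpIntegral, integral_marchenkoPastur]
    field_simp
  | succ p ih =>
    have h1 := integral_pow_succ_mul_marchenkoPastur p
    have h2 := catalan_succ_mul p
    have h3 : (p : ℝ) + 2 ≠ 0 := by positivity
    refine mul_left_cancel₀ h3 ?_
    rw [h2, ← ih, mpIntegral, mpIntegral]
    linear_combination 1 / (2 * Real.pi) * h1

end XLaguerre

/-! ### From moments to bounded continuous test functions. -/

namespace XLaguerre

open Polynomial Filter Topology MeasureTheory

theorem abs_mpIntegral_sub_le {f F h : ℝ → ℝ}
    (hf : IntervalIntegrable (fun x : ℝ => f x * √((4 - x) / x)) volume 0 4)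
    (hF : IntervalIntegrable (fun x : ℝ => F x * √((4 - x) / x)) volume 0 4)
    (hh : IntervalIntegrable (fun x : ℝ => h x * √((4 - x) / x)) volume 0 4)
    (hle : ∀ x, 0 < x → x ≤ 4 → |f x - F x| ≤ h x) :
    |mpIntegral f - mpIntegral F| ≤ mpIntegral h := by
  rw [mpIntegral, mpIntegral, mpIntegral, ← mul_sub, ← intervalIntegral.integral_sub hf hF, abs_mul,
    abs_of_pos (by positivity : (0 : ℝ) < 1 / (2 * Real.pi))]
  refine mul_le_mul_of_nonneg_left ?_ (by positivity)
  rw [← Real.norm_eq_abs]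
  refine intervalIntegral.norm_integral_le_of_norm_le (by norm_num) (.of_forall fun x hx => ?_) hh
  rw [← sub_mul, norm_mul, Real.norm_of_nonneg (Real.sqrt_nonneg _)]
  exact mul_le_mul_of_nonneg_right (hle x hx.1 hx.2) (Real.sqrt_nonneg _)

theorem mpIntegral_const (c : ℝ) : mpIntegral (fun _ => c) = c := by
  rw [mpIntegral, intervalIntegral.integral_const_mul, integral_marchenkoPastur]
  field_simp

theorem mpIntegral_const_mul (c : ℝ) (h : ℝ → ℝ) :
    mpIntegral (fun x => c * h x) = c * mpIntegral h := by
  simp only [mpIntegral, mul_assoc]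
  rw [intervalIntegral.integral_const_mul]
  ring

theorem mpIntegral_add {f g : ℝ → ℝ} (hf : ContinuousOn f (Set.Icc 0 4))
    (hg : ContinuousOn g (Set.Icc 0 4)) :
    mpIntegral (fun x => f x + g x) = mpIntegral f + mpIntegral g := by
  simp only [mpIntegral, add_mul]
  rw [intervalIntegral.integral_add (intervalIntegrable_mul_marchenkoPastur hf)
    (intervalIntegrable_mul_marchenkoPastur hg)]
  ring

/-- The average of `h` over the points of `Z` rescaled by `N`. -/
noncomputable def empirical (Z : Multiset ℝ) (N : ℝ) (h : ℝ → ℝ) : ℝ :=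
  (Z.map fun x => h (x / N)).sum / N

theorem empirical_add (Z : Multiset ℝ) (N : ℝ) (f g : ℝ → ℝ) :
    empirical Z N (fun x => f x + g x) = empirical Z N f + empirical Z N g := by
  simp only [empirical, Multiset.sum_map_add, add_div]

theorem empirical_const_mul (Z : Multiset ℝ) (N c : ℝ) (f : ℝ → ℝ) :
    empirical Z N (fun x => c * f x) = c * empirical Z N f := by
  simp only [empirical, Multiset.sum_map_mul_left, mul_div_assoc]

theorem empirical_const {Z : Multiset ℝ} (hZ : 0 < Multiset.card Z) (c : ℝ) :
    empirical Z (Multiset.card Z) (fun _ => c) = c := by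
  have : (Multiset.card Z : ℝ) ≠ 0 := by positivity
  simp only [empirical, Multiset.map_const', Multiset.sum_replicate, nsmul_eq_mul]
  field_simp

theorem abs_empirical_sub_le {Z : Multiset ℝ} {N : ℝ} (hN : 0 ≤ N) {f F h : ℝ → ℝ}
    (hle : ∀ x ∈ Z, |f (x / N) - F (x / N)| ≤ h (x / N)) :
    |empirical Z N f - empirical Z N F| ≤ empirical Z N h := by
  simp only [empirical]
  rw [← sub_div, ← Multiset.sum_map_sub, abs_div, abs_of_nonneg hN]
  refine div_le_div_of_nonneg_right ?_ hN
  refine (Multiset.abs_sum_le_sum_abs).trans ?_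
  rw [Multiset.map_map]
  exact Multiset.sum_map_le_sum_map _ _ hle

theorem tendsto_of_forall_approx {u : ℕ → ℝ} {a : ℝ}
    (h : ∀ ε > 0, ∃ (v w : ℕ → ℝ) (b c : ℝ), Tendsto v atTop (𝓝 b) ∧ Tendsto w atTop (𝓝 c) ∧
      c < ε ∧ |a - b| ≤ c ∧ ∀ᶠ n in atTop, |u n - v n| ≤ w n) : Tendsto u atTop (𝓝 a) := by
  rw [Metric.tendsto_nhds]
  intro ε hε
  obtain ⟨v, w, b, c, hv, hw, hc, hab, huv⟩ := h (ε / 3) (by positivity)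
  filter_upwards [huv, Metric.tendsto_nhds.1 hv (ε / 3) (by positivity), hw.eventually_lt_const hc]
    with n h1 h2 h3
  rw [Real.dist_eq] at h2 ⊢
  have h4 : |u n - a| ≤ |u n - v n| + |v n - b| + |a - b| := by
    rw [abs_sub_comm a b]
    calc |u n - a| = |(u n - v n) + (v n - b) + (b - a)| := by ring_nf
      _ ≤ _ := abs_add_three _ _ _
  linarith

theorem abs_min_pow_sub_pow_le {y : ℝ} (hy : 0 < y) (p k : ℕ) :
    |(min y 5) ^ p - y ^ p| ≤ y ^ (p + k) / 5 ^ k := by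
  rcases le_total y 5 with h | h
  · rw [min_eq_left h, sub_self, abs_zero]
    positivity
  · rw [min_eq_right h, abs_sub_comm, abs_of_nonneg (sub_nonneg.2 (pow_le_pow_left₀ (by norm_num) h p)),
      le_div_iff₀ (by positivity), pow_add]
    have h1 : (5 : ℝ) ^ k ≤ y ^ k := pow_le_pow_left₀ (by norm_num) h k
    have h2 : (0 : ℝ) ≤ 5 ^ p := by positivity
    exact mul_le_mul (by linarith) h1 (by positivity) (by positivity)

/-- Moment convergence to the Catalan numbers gives convergence of truncated moments. -/
theorem tendsto_empirical_min_pow {Z : ℕ → Multiset ℝ} {N : ℕ → ℝ}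
    (hZ : ∀ᶠ n in atTop, 0 < N n ∧ ∀ x ∈ Z n, 0 < x)
    (hm : ∀ p : ℕ, Tendsto (fun n => empirical (Z n) (N n) fun x => x ^ p) atTop (𝓝 (catalan p)))
    (p : ℕ) :
    Tendsto (fun n => empirical (Z n) (N n) fun x => (min x 5) ^ p) atTop (𝓝 (catalan p)) := by
  refine tendsto_of_forall_approx fun ε hε => ?_
  -- The truncation error is at most the moment of order `p + k` divided by `5 ^ k`, with limit
  -- `catalan (p + k) / 5 ^ k ≤ 4 ^ p * (4 / 5) ^ k`. It is small because the level `5` exceeds the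
  -- right end `4` of the support.
  obtain ⟨k, hk⟩ : ∃ k : ℕ, (4 : ℝ) ^ p * (4 / 5) ^ k < ε := by
    have : Tendsto (fun k : ℕ => (4 : ℝ) ^ p * (4 / 5) ^ k) atTop (𝓝 (4 ^ p * 0)) :=
      (tendsto_pow_atTop_nhds_zero_of_lt_one (by norm_num) (by norm_num)).const_mul _
    rw [mul_zero] at this
    exact (this.eventually_lt_const hε).exists
  refine ⟨_, fun n => (1 / 5 ^ k) * empirical (Z n) (N n) fun x => x ^ (p + k), _, _, hm p,
    (hm (p + k)).const_mul _, ?_, ?_, ?_⟩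
  · refine lt_of_le_of_lt ?_ hk
    have := catalan_le_four_pow (p + k)
    rw [div_pow, one_div, inv_mul_eq_div, mul_div_assoc', ← pow_add]
    exact div_le_div_of_nonneg_right this (by positivity)
  · rw [sub_self, abs_zero]
    positivity
  · filter_upwards [hZ] with n hn
    rw [← empirical_const_mul]
    refine abs_empirical_sub_le hn.1.le fun x hx => ?_
    refine (abs_min_pow_sub_pow_le (div_pos (hn.2 x hx) hn.1) p k).trans_eq ?_
    ring

theorem tendsto_empirical_min_polynomial {Z : ℕ → Multiset ℝ} {N : ℕ → ℝ}
    (hZ : ∀ᶠ n in atTop, 0 < N n ∧ ∀ x ∈ Z n, 0 < x)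
    (hm : ∀ p : ℕ, Tendsto (fun n => empirical (Z n) (N n) fun x => x ^ p) atTop (𝓝 (catalan p)))
    (q : ℝ[X]) :
    Tendsto (fun n => empirical (Z n) (N n) fun x => q.eval (min x 5)) atTop
      (𝓝 (mpIntegral fun x => q.eval x)) := by
  induction q using Polynomial.induction_on' with
  | add p q hp hq =>
    simp only [eval_add, empirical_add]
    rw [mpIntegral_add p.continuousOn q.continuousOn]
    exact hp.add hq
  | monomial m c =>
    simp only [eval_monomial, empirical_const_mul]
    rw [mpIntegral_const_mul, mpIntegral_pow]
    exact (tendsto_empirical_min_pow hZ hm m).const_mul c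

theorem abs_sum_multiset_map_le {R : Multiset ℝ} {g : ℝ → ℝ} {B : ℝ} (h : ∀ x ∈ R, |g x| ≤ B) :
    |(R.map g).sum| ≤ Multiset.card R * B := by
  refine Multiset.abs_sum_le_sum_abs.trans ?_
  rw [Multiset.map_map]
  have := Multiset.sum_le_card_nsmul (R.map (abs ∘ g)) B (by simpa using h)
  simpa using this

/-- The multiset `Z` of positive reals interlaces with the finite set `S`, up to `c` exceptions in
each of them. -/
def AlmostInterlacing (c : ℕ) (Z : Multiset ℝ) (S : Finset ℝ) : Prop :=
  ∃ Y W : Finset ℝ, W.val ≤ Z ∧ Y ⊆ S ∧ W.card = Y.card ∧ Multiset.card Z ≤ Y.card + c ∧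
    S.card ≤ Y.card + c ∧
    ∀ g φ : ℝ → ℝ, (∀ x y, 0 < x → x ≤ y → φ x ≤ φ y ∧ |g x - g y| ≤ φ y - φ x) →
      (∀ x, 0 < x → 0 ≤ φ x) → ∀ M, (∀ x, 0 < x → φ x ≤ M) → 0 ≤ M →
      |∑ z ∈ W, g z - ∑ y ∈ Y, g y| ≤ M

/-- The paired points contribute at most the variation bound `M`; at most `c` unpaired points on
each side contribute `B` each. -/
theorem AlmostInterlacing.abs_sum_sub_sum_le {c : ℕ} {Z : Multiset ℝ} {S : Finset ℝ}
    (h : AlmostInterlacing c Z S) (hZ : ∀ x ∈ Z, 0 < x) (hS : ∀ x ∈ S, 0 < x) {g φ : ℝ → ℝ}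
    {M B : ℝ} (hg : ∀ x y, 0 < x → x ≤ y → φ x ≤ φ y ∧ |g x - g y| ≤ φ y - φ x)
    (hφ : ∀ x, 0 < x → 0 ≤ φ x) (hM : ∀ x, 0 < x → φ x ≤ M) (hM0 : 0 ≤ M)
    (hB : ∀ x, 0 < x → |g x| ≤ B) (hB0 : 0 ≤ B) :
    |(Z.map g).sum - (S.val.map g).sum| ≤ M + 2 * (c * B) := by
  classical
  obtain ⟨Y, W, hWZ, hYS, hWY, hZc, hSc, hint⟩ := h
  obtain ⟨R, rfl⟩ := Multiset.le_iff_exists_add.1 hWZ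
  have h1 := hint g φ hg hφ M hM hM0
  have h2 : |(R.map g).sum| ≤ c * B := by
    refine (abs_sum_multiset_map_le fun x hx => hB x (hZ x (Multiset.mem_add.2 (.inr hx)))).trans ?_
    refine mul_le_mul_of_nonneg_right ?_ hB0
    rw [Multiset.card_add, Finset.card_val, hWY] at hZc
    exact_mod_cast (by omega)
  have h3 : |∑ x ∈ S \ Y, g x| ≤ c * B := by
    have := abs_sum_multiset_map_le (R := (S \ Y).val) (g := g) (B := B) fun x hx =>
      hB x (hS x (Finset.mem_sdiff.1 hx).1)
    refine this.trans (mul_le_mul_of_nonneg_right ?_ hB0)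
    rw [Finset.card_val, Finset.card_sdiff_of_subset hYS]
    exact_mod_cast (by omega)
  have h4 : (S.val.map g).sum = ∑ x ∈ S \ Y, g x + ∑ x ∈ Y, g x := (Finset.sum_sdiff hYS).symm
  have h5 : ((W.val + R).map g).sum = ∑ x ∈ W, g x + (R.map g).sum := by
    rw [Multiset.map_add, Multiset.sum_add]
    rfl
  rw [h4, h5]
  rw [abs_le] at h1 h2 h3 ⊢
  constructor <;> linarith [h1.1, h1.2, h2.1, h2.2, h3.1, h3.2]

theorem exists_lipschitz_bound (q : ℝ[X]) : ∃ L B : ℝ, 0 ≤ L ∧ 0 ≤ B ∧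
    (∀ x ∈ Set.Icc (0 : ℝ) 5, |q.eval x| ≤ B) ∧
    ∀ x ∈ Set.Icc (0 : ℝ) 5, ∀ y ∈ Set.Icc (0 : ℝ) 5, x ≤ y →
      |q.eval x - q.eval y| ≤ L * (y - x) := by
  obtain ⟨B, hB⟩ := isCompact_Icc.exists_bound_of_continuousOn
    (q.continuousOn (s := Set.Icc (0 : ℝ) 5))
  obtain ⟨L, hL⟩ := isCompact_Icc.exists_bound_of_continuousOn
    ((derivative q).continuousOn (s := Set.Icc (0 : ℝ) 5))
  have h0 : (0 : ℝ) ∈ Set.Icc (0 : ℝ) 5 := by norm_num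
  refine ⟨L, B, (norm_nonneg _).trans (hL 0 h0), (norm_nonneg _).trans (hB 0 h0), hB, ?_⟩
  intro x hx y hy hxy
  have := (convex_Icc (0 : ℝ) 5).norm_image_sub_le_of_norm_hasDerivWithin_le
    (f := fun x => q.eval x) (fun x _ => (q.hasDerivAt x).hasDerivWithinAt) hL hy hx
  simpa [Real.norm_eq_abs, abs_of_nonpos (sub_nonpos.2 hxy)] using this

/-- Truncation at `5` gives the rescaled test function a sup bound and a variation bound independent
of `N`, so the two sums differ by `O(1)` and the averages by `O(1 / N)`. -/
theorem tendsto_empirical_of_almostInterlacing {c : ℕ} {Z : ℕ → Multiset ℝ} {S : ℕ → Finset ℝ}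
    {N : ℕ → ℝ} (hN : Tendsto N atTop atTop)
    (h : ∀ᶠ n in atTop, AlmostInterlacing c (Z n) (S n) ∧ (∀ x ∈ Z n, 0 < x) ∧ ∀ x ∈ S n, 0 < x)
    (q : ℝ[X]) {a : ℝ}
    (ha : Tendsto (fun n => empirical (S n).val (N n) fun x => q.eval (min x 5)) atTop (𝓝 a)) :
    Tendsto (fun n => empirical (Z n) (N n) fun x => q.eval (min x 5)) atTop (𝓝 a) := by
  obtain ⟨L, B, hL, hB, hqB, hqL⟩ := exists_lipschitz_bound q
  refine tendsto_of_forall_approx fun ε hε => ⟨_, fun n => (L * 5 + 2 * (c * B)) * (N n)⁻¹, a,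
    (L * 5 + 2 * (c * B)) * 0, ha, hN.inv_tendsto_atTop.const_mul _, by simpa using hε,
    by simp, ?_⟩
  filter_upwards [h, hN.eventually_gt_atTop 0] with n hn hpos
  have hmem : ∀ x, 0 < x → min (x / N n) 5 ∈ Set.Icc (0 : ℝ) 5 := fun x hx =>
    ⟨le_min (by positivity) (by norm_num), min_le_right _ _⟩
  rw [empirical, empirical, ← sub_div, abs_div, abs_of_pos hpos, div_eq_mul_inv]
  refine mul_le_mul_of_nonneg_right ?_ (by positivity)
  refine hn.1.abs_sum_sub_sum_le hn.2.1 hn.2.2 (φ := fun x => L * min (x / N n) 5) ?_ ?_ ?_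
    (by positivity) (fun x hx => hqB _ (hmem x hx)) hB
  · intro x y hx hxy
    have h1 : min (x / N n) 5 ≤ min (y / N n) 5 :=
      min_le_min_right _ (div_le_div_of_nonneg_right hxy hpos.le)
    refine ⟨mul_le_mul_of_nonneg_left h1 hL, ?_⟩
    rw [← mul_sub]
    exact hqL _ (hmem x hx) _ (hmem y (hx.trans_le hxy)) h1
  · exact fun x hx => mul_nonneg hL (hmem x hx).1
  · exact fun x hx => mul_le_mul_of_nonneg_left (hmem x hx).2 hL

theorem tendsto_empirical_min_continuousOn {Z : ℕ → Multiset ℝ}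
    (hZ : ∀ᶠ n in atTop, 0 < Multiset.card (Z n) ∧ ∀ x ∈ Z n, 0 < x)
    (h : ∀ q : ℝ[X], Tendsto (fun n => empirical (Z n) (Multiset.card (Z n)) fun x =>
      q.eval (min x 5)) atTop (𝓝 (mpIntegral fun x => q.eval x)))
    {F : ℝ → ℝ} (hF : ContinuousOn F (Set.Icc 0 5)) :
    Tendsto (fun n => empirical (Z n) (Multiset.card (Z n)) fun x => F (min x 5)) atTop
      (𝓝 (mpIntegral F)) := by
  refine tendsto_of_forall_approx fun ε hε => ?_
  obtain ⟨q, hq⟩ := exists_polynomial_near_of_continuousOn 0 5 F hF (ε / 2) (by positivity)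
  have hcont : ContinuousOn F (Set.Icc 0 4) := hF.mono (Set.Icc_subset_Icc_right (by norm_num))
  refine ⟨_, fun _ => ε / 2, _, ε / 2, h q, tendsto_const_nhds, by linarith, ?_, ?_⟩
  · conv_rhs => rw [← mpIntegral_const (ε / 2)]
    refine abs_mpIntegral_sub_le (intervalIntegrable_mul_marchenkoPastur hcont)
      (intervalIntegrable_mul_marchenkoPastur q.continuousOn)
      (intervalIntegrable_mul_marchenkoPastur continuousOn_const) fun x h0 h4 => ?_
    rw [abs_sub_comm]
    exact (hq x ⟨h0.le, h4.trans (by norm_num)⟩).le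
  · filter_upwards [hZ] with n hn
    conv_rhs => rw [← empirical_const hn.1 (ε / 2)]
    have hpos : (0 : ℝ) < Multiset.card (Z n) := by exact_mod_cast hn.1
    refine abs_empirical_sub_le hpos.le fun x hx => ?_
    rw [abs_sub_comm]
    exact (hq _ ⟨le_min (div_pos (hn.2 x hx) hpos).le (by norm_num), min_le_right _ _⟩).le

/-- The cutoff is at least `1` on `(0, δ]` and at `5`, the places where truncated test functions may
be wrong. Its second summand vanishes on `[0, 4]`, and the first has small integral as `δ → 0` by
dominated convergence. -/
theorem exists_mpIntegral_cutoff_lt {ε : ℝ} (hε : 0 < ε) : ∃ δ : ℝ, 0 < δ ∧ δ ≤ 1 ∧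
    mpIntegral (fun x => max 0 (2 - x / δ) + max 0 (x - 4)) < ε := by
  have hlim : Tendsto (fun n : ℕ => ∫ x in (0 : ℝ)..4,
      (max 0 (2 - x / (1 / ((n : ℝ) + 1))) + max 0 (x - 4)) * √((4 - x) / x)) atTop
      (𝓝 (∫ x in (0 : ℝ)..4, (0 : ℝ))) := by
    refine intervalIntegral.tendsto_integral_filter_of_dominated_convergence
      (fun x => 2 * √((4 - x) / x)) (.of_forall fun n => ?_) (.of_forall fun n => .of_forall ?_)
      (intervalIntegrable_marchenkoPastur.const_mul 2) (.of_forall fun x hx => ?_)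
    · have := intervalIntegrable_mul_marchenkoPastur
        (h := fun x => max 0 (2 - x / (1 / ((n : ℝ) + 1))) + max 0 (x - 4)) (by fun_prop)
      rw [Set.uIoc_of_le (by norm_num)]
      exact this.1.aestronglyMeasurable
    · intro x hx
      rw [Set.uIoc_of_le (by norm_num)] at hx
      have hx0 := hx.1
      have h1 : 0 ≤ x / (1 / ((n : ℝ) + 1)) := by positivity
      rw [max_eq_left (sub_nonpos.2 hx.2), add_zero, norm_mul,
        Real.norm_of_nonneg (Real.sqrt_nonneg _), Real.norm_of_nonneg (le_max_left _ _)]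
      exact mul_le_mul_of_nonneg_right (max_le (by norm_num) (by linarith)) (Real.sqrt_nonneg _)
    · rw [Set.uIoc_of_le (by norm_num)] at hx
      refine tendsto_const_nhds.congr' ?_
      obtain ⟨m, hm⟩ := exists_nat_gt (2 / x)
      filter_upwards [eventually_ge_atTop m] with n hn
      have h1 : (m : ℝ) ≤ n := by exact_mod_cast hn
      have h2 : 2 < m * x := (div_lt_iff₀ hx.1).1 hm
      have h3 : 2 - x / (1 / ((n : ℝ) + 1)) ≤ 0 := by
        rw [div_div_eq_mul_div, div_one]
        nlinarith [hx.1]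
      rw [max_eq_left h3, max_eq_left (sub_nonpos.2 hx.2)]
      simp
  have hlim' := hlim.const_mul (1 / (2 * Real.pi))
  rw [intervalIntegral.integral_zero, mul_zero] at hlim'
  obtain ⟨n, hn⟩ := (hlim'.eventually_lt_const hε).exists
  refine ⟨1 / ((n : ℝ) + 1), by positivity, ?_, hn⟩
  rw [div_le_one (by positivity)]
  linarith [(Nat.cast_nonneg n : (0 : ℝ) ≤ n)]

theorem intervalIntegrable_bounded_mul_marchenkoPastur {f : ℝ → ℝ} {B : ℝ}
    (hf : ContinuousOn f (Set.Ioi 0)) (hB : ∀ x, 0 < x → |f x| ≤ B) :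
    IntervalIntegrable (fun x : ℝ => f x * √((4 - x) / x)) volume 0 4 := by
  have h := intervalIntegrable_marchenkoPastur
  rw [intervalIntegrable_iff_integrableOn_Ioc_of_le (by norm_num)] at h ⊢
  refine Integrable.bdd_mul (c := B) h
    ((hf.mono Set.Ioc_subset_Ioi_self).aestronglyMeasurable measurableSet_Ioc) ?_
  exact (ae_restrict_iff' measurableSet_Ioc).2 (.of_forall fun x hx => hB x hx.1)

theorem tendsto_empirical_of_bounded_continuousOn {Z : ℕ → Multiset ℝ}
    (hZ : ∀ᶠ n in atTop, 0 < Multiset.card (Z n) ∧ ∀ x ∈ Z n, 0 < x)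
    (h : ∀ q : ℝ[X], Tendsto (fun n => empirical (Z n) (Multiset.card (Z n)) fun x =>
      q.eval (min x 5)) atTop (𝓝 (mpIntegral fun x => q.eval x)))
    {f : ℝ → ℝ} {B : ℝ} (hf : ContinuousOn f (Set.Ioi 0)) (hB : ∀ x, 0 < x → |f x| ≤ B) :
    Tendsto (fun n => empirical (Z n) (Multiset.card (Z n)) f) atTop (𝓝 (mpIntegral f)) := by
  have hB0 : 0 ≤ B := (abs_nonneg _).trans (hB 1 one_pos)
  refine tendsto_of_forall_approx fun ε hε => ?_
  obtain ⟨δ, hδ, hδ1, hδε⟩ :=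
    exists_mpIntegral_cutoff_lt (ε := ε / (2 * B + 1)) (by positivity)
  set H : ℝ → ℝ := fun x => 2 * B * (max 0 (2 - x / δ) + max 0 (x - 4)) with hH
  -- `f` need not extend continuously to `0`, so it is frozen below `δ`. After truncation at `5`,
  -- the error is at most `2 * B` and occurs only for `y < δ` or `y > 5`, where `H (min y 5) ≥ 2 *
  -- B`.
  set F : ℝ → ℝ := fun x => f (max x δ) with hF
  have hHc : Continuous H := by
    have : Continuous fun x : ℝ => x / δ := continuous_id.div_const δ
    fun_prop
  have hFc : Continuous F := by
    rw [← continuousOn_univ]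
    exact hf.comp (by fun_prop) fun x _ => lt_max_of_lt_right hδ
  have hle : ∀ y, 0 < y → |f y - F (min y 5)| ≤ H (min y 5) := by
    intro y hy
    have h2 : |f y - F (min y 5)| ≤ 2 * B := by
      have h3 := hB y hy
      have h4 := hB (max (min y 5) δ) (lt_max_of_lt_right hδ)
      refine (abs_sub _ _).trans ?_
      rw [hF]
      linarith
    have hnn : ∀ x, 0 ≤ max 0 (2 - x / δ) + max 0 (x - 4) := fun x =>
      add_nonneg (le_max_left _ _) (le_max_left _ _)
    rcases lt_or_ge y δ with h5 | h5
    · refine h2.trans (le_mul_of_one_le_right (by positivity) ?_)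
      rw [min_eq_left (by linarith)]
      have h6 : y / δ ≤ 1 := (div_le_one hδ).2 h5.le
      have := le_max_right 0 (2 - y / δ)
      have := le_max_left 0 (y - 4)
      linarith
    · rcases le_or_gt y 5 with h6 | h6
      · rw [min_eq_left h6, hF]
        simp only [max_eq_left h5, sub_self, abs_zero]
        exact mul_nonneg (by positivity) (hnn _)
      · refine h2.trans (le_mul_of_one_le_right (by positivity) ?_)
        rw [min_eq_right h6.le]
        exact (zero_add (1 : ℝ)).symm.trans_le
          (add_le_add (le_max_left _ _) (le_max_of_le_right (by norm_num)))
  refine ⟨_, _, _, _, tendsto_empirical_min_continuousOn hZ h hFc.continuousOn,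
    tendsto_empirical_min_continuousOn hZ h hHc.continuousOn, ?_, ?_, ?_⟩
  · rw [hH, mpIntegral_const_mul]
    rw [lt_div_iff₀ (by positivity)] at hδε
    have h1 : 0 ≤ mpIntegral fun x => max 0 (2 - x / δ) + max 0 (x - 4) := by
      refine mul_nonneg (by positivity) (intervalIntegral.integral_nonneg (by norm_num) fun x _ => ?_)
      exact mul_nonneg (add_nonneg (le_max_left _ _) (le_max_left _ _)) (Real.sqrt_nonneg _)
    linarith
  · refine abs_mpIntegral_sub_le (intervalIntegrable_bounded_mul_marchenkoPastur hf hB)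
      (intervalIntegrable_mul_marchenkoPastur hFc.continuousOn)
      (intervalIntegrable_mul_marchenkoPastur hHc.continuousOn) fun x h0 h4 => ?_
    have := hle x h0
    rwa [min_eq_left (by linarith)] at this
  · filter_upwards [hZ] with n hn
    have hpos : (0 : ℝ) < Multiset.card (Z n) := by exact_mod_cast hn.1
    exact abs_empirical_sub_le (h := fun x => H (min x 5)) hpos.le fun x hx =>
      hle _ (div_pos (hn.2 x hx) hpos)

end XLaguerre

/-! ### Assembly of the proof. -/

namespace XLaguerre

open Polynomial Filter Topology

theorem exists_laguerre_nodes {β : ℝ} (hβ : -1 < β) (K : ℕ) : ∃ S : Finset ℝ, S.card = K ∧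
    (∀ x ∈ S, 0 < x) ∧ SatisfiesODE β K (Lagrange.nodal S id) ∧
    OrthBelow (gammaFunctional hβ) (Lagrange.nodal S id) S.card := by
  have hode := satisfiesODE_laguerre β K
  have horth := orthBelow_of_satisfiesODE (gammaFunctional_integrationByParts hβ) hode
  obtain ⟨S, hcard, hpos, hS⟩ := OrthBelow.exists_nodal (gammaFunctional_pos hβ)
    (laguerre_ne_zero β K) (by rwa [natDegree_laguerre])
  rw [natDegree_laguerre] at hcard
  set l := (laguerre β K).leadingCoeff with hl
  have hl0 : l ≠ 0 := leadingCoeff_ne_zero.2 (laguerre_ne_zero β K)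
  have hnode : SatisfiesODE β K (Lagrange.nodal S id) := by
    have := hode.eq
    rw [hS] at this
    simp only [derivative_C_mul] at this
    refine (mul_eq_zero.1 (?_ : C l * _ = 0)).resolve_left (C_ne_zero.2 hl0)
    linear_combination this
  refine ⟨S, hcard, hpos, hnode, ?_⟩
  rw [hcard]
  exact orthBelow_of_satisfiesODE (gammaFunctional_integrationByParts hβ) hnode

theorem tendsto_lastDegree {r₁ r₂ : ℕ} (lam : Fin r₁ → ℕ) (mu : Fin r₂ → ℕ) :
    Tendsto (lastDegree lam mu) atTop atTop := by
  refine tendsto_atTop.2 fun b => ?_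
  filter_upwards [eventually_ge_atTop (b + (weight lam + weight mu))] with n hn
  unfold lastDegree
  omega

/-- The regular zeros interlace with the zeros of Laguerre polynomials with parameter `α + r`, up
to boundedly many exceptions. -/
theorem exists_almostInterlacing (α : ℝ) {r₁ r₂ : ℕ} {lam : Fin r₁ → ℕ} {mu : Fin r₂ → ℕ}
    (hlam : IsPartition lam) (hmu : IsPartition mu) (hα : -1 < α + ((r₁ + r₂ : ℕ) : ℝ)) :
    ∃ (c : ℕ) (S : ℕ → Finset ℝ), ∀ᶠ n in atTop,
      AlmostInterlacing c (regularZeros α lam mu n) (S n) ∧ (∀ x ∈ S n, 0 < x) ∧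
      n ≤ (S n).card + (weight lam + weight mu) ∧
      numRegularZeros α lam mu n ≤ (S n).card ∧ (S n).card ≤ numRegularZeros α lam mu n + c ∧
      SatisfiesODE (α + ((r₁ + r₂ : ℕ) : ℝ)) (S n).card (Lagrange.nodal (S n) id) := by
  obtain ⟨d, hd⟩ := exists_orthBelow_exceptionalLaguerre α lam mu
    (gammaFunctional_integrationByParts hα)
  choose T hcard hpos hode horth using exists_laguerre_nodes hα
  -- There are `s + d` nodes, enough to bound `deg P`, and at least `s - d` interlacing pairs; the
  -- gap `2 * d` bounds the exceptions on both sides.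
  refine ⟨2 * d, fun n => T (lastDegree lam mu n + d), ?_⟩
  filter_upwards [(tendsto_lastDegree lam mu).eventually_ge_atTop
    (d + Finset.univ.sup (degreeOf lam) + 1)] with n hn
  obtain ⟨hdeg, hP⟩ := hd n
  -- For large `n` the last degree exceeds every `degreeOf lam i`, so the degrees of the polynomial
  -- rows are distinct.
  have hP0 : exceptionalLaguerre α lam mu n ≠ 0 := by
    refine exceptionalLaguerre_ne_zero α hlam hmu fun i => ?_
    have := Finset.le_sup (f := degreeOf lam) (Finset.mem_univ i)
    omega
  set K := lastDegree lam mu n + d with hK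
  obtain ⟨Y, W, hY, hWY, hYS, hW, hint⟩ := OrthBelow.exists_interlacing (gammaFunctional_pos hα)
    (hpos K) (horth K) (hdeg.trans (hcard K).ge) hP (by rw [hcard]; omega)
  have hWle : W.val ≤ regularZeros α lam mu n := by
    rw [Multiset.le_iff_subset W.nodup]
    intro z hz
    exact Multiset.mem_filter.2 ⟨(mem_roots hP0).2 (hW z hz).1, (hW z hz).2⟩
  have hNle : numRegularZeros α lam mu n ≤ K :=
    (Multiset.card_le_card (Multiset.filter_le _ _)).trans ((card_roots' _).trans hdeg)
  have hleN : W.card ≤ numRegularZeros α lam mu n := Multiset.card_le_card hWle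
  refine ⟨⟨Y, W, hWle, hYS, hWY, ?_, ?_, hint⟩, hpos K, ?_, ?_, ?_, ?_⟩
  · change numRegularZeros α lam mu n ≤ _
    omega
  · rw [hcard]; omega
  · rw [hcard, hK, lastDegree]; omega
  · rw [hcard]; exact hNle
  · rw [hcard]; omega
  · rw [hcard]; exact hode K

theorem tendsto_empirical_regularZeros (α : ℝ) {r₁ r₂ : ℕ} {lam : Fin r₁ → ℕ} {mu : Fin r₂ → ℕ}
    (hlam : IsPartition lam) (hmu : IsPartition mu) (hα : -1 < α + ((r₁ + r₂ : ℕ) : ℝ))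
    {f : ℝ → ℝ} {B : ℝ} (hf : ContinuousOn f (Set.Ioi 0)) (hB : ∀ x, 0 < x → |f x| ≤ B) :
    Tendsto (fun n => empirical (regularZeros α lam mu n) (numRegularZeros α lam mu n) f) atTop
      (𝓝 (mpIntegral f)) := by
  obtain ⟨c, S, hS⟩ := exists_almostInterlacing α hlam hmu hα
  have hNnat : Tendsto (numRegularZeros α lam mu) atTop atTop := by
    refine tendsto_atTop.2 fun b => ?_
    filter_upwards [hS, eventually_ge_atTop (b + c + (weight lam + weight mu))] with n hn hb
    obtain ⟨-, -, h1, -, h2, -⟩ := hn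
    omega
  have hN : Tendsto (fun n => (numRegularZeros α lam mu n : ℝ)) atTop atTop :=
    tendsto_natCast_atTop_atTop.comp hNnat
  have hratio : Tendsto (fun n => ((S n).card : ℝ) / (numRegularZeros α lam mu n : ℝ)) atTop
      (𝓝 1) := by
    refine tendsto_of_forall_approx fun ε hε =>
      ⟨fun _ => 1, fun n => c * (numRegularZeros α lam mu n : ℝ)⁻¹, 1, c * 0, tendsto_const_nhds,
        hN.inv_tendsto_atTop.const_mul _, by simpa using hε, by simp, ?_⟩
    filter_upwards [hS, hN.eventually_gt_atTop 0] with n hn hpos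
    obtain ⟨-, -, -, h1, h2, -⟩ := hn
    have h1' : (numRegularZeros α lam mu n : ℝ) ≤ (S n).card := by exact_mod_cast h1
    have h2' : ((S n).card : ℝ) ≤ numRegularZeros α lam mu n + c := by exact_mod_cast h2
    rw [div_sub_one hpos.ne', abs_div, abs_of_pos hpos, abs_of_nonneg (by linarith),
      div_eq_mul_inv]
    exact mul_le_mul_of_nonneg_right (by linarith) (by positivity)
  have hZpos : ∀ n, ∀ x ∈ regularZeros α lam mu n, 0 < x := fun n x hx =>
    (Multiset.mem_filter.1 hx).2
  have hmoment : ∀ p : ℕ, Tendsto (fun n => empirical (S n).val (numRegularZeros α lam mu n)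
      fun x => x ^ p) atTop (𝓝 (catalan p)) := by
    intro p
    refine (tendsto_sum_pow_div (hS.mono fun n hn => hn.2.2.2.2.2) hN hratio p).congr fun n => ?_
    rw [empirical, pow_succ, ← div_div, Finset.sum_div]
    simp only [div_pow]
    rfl
  refine tendsto_empirical_of_bounded_continuousOn (Z := regularZeros α lam mu) ?_ (fun q => ?_)
    hf hB
  · filter_upwards [hNnat.eventually_gt_atTop 0] with n hn
    exact ⟨hn, hZpos n⟩
  · refine tendsto_empirical_of_almostInterlacing (c := c) (S := S) hN ?_ q
      (tendsto_empirical_min_polynomial ?_ hmoment q)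
    · exact hS.mono fun n hn => ⟨hn.1, hZpos n, hn.2.1⟩
    · filter_upwards [hS, hN.eventually_gt_atTop 0] with n hn hpos
      exact ⟨hpos, hn.2.1⟩

end XLaguerre

theorem mainTheorem2 (α : ℝ) {r₁ r₂ : ℕ} (lam : Fin r₁ → ℕ) (mu : Fin r₂ → ℕ)
    (hlam : XLaguerre.IsPartition lam) (hmu : XLaguerre.IsPartition mu)
    (hα : -1 < α + ((r₁ + r₂ : ℕ) : ℝ))
    (f : ℝ → ℝ) (hf : ContinuousOn f (Set.Ioi 0)) (hfb : ∃ B : ℝ, ∀ x, 0 < x → |f x| ≤ B) :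
    Filter.Tendsto
      (fun n : ℕ =>
        1 / (XLaguerre.numRegularZeros α lam mu n : ℝ) *
          ((XLaguerre.regularZeros α lam mu n).map
            (fun x => f (x / (XLaguerre.numRegularZeros α lam mu n : ℝ)))).sum)
      (Filter.atTop ⊓ Filter.principal (XLaguerre.degreeSequence lam mu))
      (nhds (1 / (2 * Real.pi) * ∫ x in (0 : ℝ)..4, f x * √((4 - x) / x))) := by
  obtain ⟨B, hB⟩ := hfb
  refine ((XLaguerre.tendsto_empirical_regularZeros α hlam hmu hα hf hB).congr
    fun n => ?_).mono_left inf_le_left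
  rw [XLaguerre.empirical, one_div_mul_eq_div]
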